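/- Let $G$ be a finite simple nonplanar graph with an edge $uv$ such that $G-uv$ is cubic, planar and $3$-connected, and suppose that $G_{u,v}:=G-\{u,v\}$ is internally $3$-connected, i.e. it is $2$-connected and whenever $G_{u,v}$ is the union of two edge-disjoint subgraphs $G_1,G_2$ with exactly two common vertices, $|E(G_1)|\le 2$ or $|E(G_2)|\le 2$. Let $u_1,u_2,u_3$ be the neighbours of $u$ other than $v$, and $v_1,v_2,v_3$ the neighbours of $v$ other than $u$. Fix a plane embedding of $G-uv$ and the embedding of $G_{u,v}$ that it induces; let $\mathcal F$ be the set of faces of the latter and $G^*_{u,v}$ its dual (multi)graph, with vertex set $\mathcal F$. For a weight assignment $\omega$ on $E(G)$, let $\omega^*$ be the weight assignment on $G^*_{u,v}$ given by $\omega^*(e^*)=\omega(e)$ for $e\in E(G_{u,v})$; let $d_{\omega^*}(F,F')$ be the length of a shortest $FF'$-path in $(G^*_{u,v},\omega^*)$, and for a vertex $x$ of $G_{u,v}$ let $d_{\omega^*}(x,F)$ be the minimum of $d_{\omega^*}(F',F)$ over the faces $F'$ incident with $x$. Then there is exactly one face $F_u\in\mathcal F$ incident with all of $u_1,u_2,u_3$,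 there is exactly one face $F_v\in\mathcal F$ incident with all of $v_1,v_2,v_3$, and there is a weight assignment $\omega$ on $E(G)$ with positive integer values such that: 1. every edge of $G^*_{u,v}$ belongs to a shortest $F_uF_v$-path in $(G^*_{u,v},\omega^*)$; 2. $\omega(e)\,\omega(e')>d_{\omega^*}(F_u,F_v)\cdot\omega(uv)$ for all edges $e,e'$ of $G_{u,v}$; 3. $\sum_{j=1}^3 d_{\omega^*}(u_j,F)\cdot\omega(uu_j)\ge d_{\omega^*}(F_u,F)\cdot\omega(uv)$ for every $F\in\mathcal F$; 4. for each $i\in\{1,2,3\}$ there is $U_i\in\mathcal F$ with $d_{\omega^*}(u_i,U_i)>0$ and $\sum_{j=1}^3 d_{\omega^*}(u_j,U_i)\cdot\omega(uu_j)=d_{\omega^*}(F_u,U_i)\cdot\omega(uv)$; 5. $\sum_{j=1}^3 d_{\omega^*}(v_j,F)\cdot\omega(vv_j)\ge d_{\omega^*}(F_v,F)\cdot\omega(uv)$ for every $F\in\mathcal F$; 6. for each $i\in\{1,2,3\}$ there is $V_i\in\mathcal F$ with $d_{\omega^*}(v_i,V_i)>0$ and $\sum_{j=1}^3 d_{\omega^*}(v_j,V_i)\cdot\omega(vv_j)=d_{\omega^*}(F_v,V_i)\cdot\omega(uv)$;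 7. $\omega(uu_i)\cdot\omega(vv_j)<\frac19\min\{\omega(e): e\in E(G_{u,v})\}$ for all $i,j\in\{1,2,3\}$. -/

import Mathlib

namespace SimpleGraph

/-- A graph is `k`-connected if it has more than `k` vertices and no set of fewer than `k` vertices
disconnects it. -/
def IsVertexConnected {V : Type*} (G : SimpleGraph V) (k : ℕ) : Prop :=
  k < Nat.card V ∧ ∀ S : Set V, S.ncard < k → (G.induce Sᶜ).Connected

/-- A separation of order `k`: two edge-disjoint subgraphs with union `G` that have exactly `k`
vertices in common. -/
def IsSeparation {V : Type*} {G : SimpleGraph V} (A B : G.Subgraph) (k : ℕ) : Prop :=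
  A ⊔ B = ⊤ ∧ Disjoint A.edgeSet B.edgeSet ∧ (A.verts ∩ B.verts).ncard = k

/-- Internally 3-connected: (simple and) 2-connected, and in every separation of order two, one of
the sides has at most two edges. -/
def IsInternallyThreeConnected {V : Type*} (G : SimpleGraph V) : Prop :=
  G.IsVertexConnected 2 ∧ ∀ A B : G.Subgraph, IsSeparation A B 2 →
    A.edgeSet.ncard ≤ 2 ∨ B.edgeSet.ncard ≤ 2

/-- A combinatorial embedding of `G` in an oriented surface: around every vertex, a cyclic order of
the darts (oriented edges) that leave it. -/
structure RotationSystem {V : Type*} (G : SimpleGraph V) where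
  /-- the next dart around the same initial vertex -/
  rot : Equiv.Perm G.Dart
  rot_fst : ∀ d, (rot d).fst = d.fst
  sameCycle : ∀ d e : G.Dart, d.fst = e.fst → rot.SameCycle d e

namespace RotationSystem

variable {V : Type*} {G : SimpleGraph V}

/-- The face-tracing permutation: traverse a dart, then turn into the next dart around its head. -/
def facePerm (R : RotationSystem G) : Equiv.Perm G.Dart :=
  (Function.Involutive.toPerm Dart.symm Dart.symm_involutive).trans R.rot

/-- The faces of the embedding (of a connected graph with an edge): the orbits of the face-tracing
permutation. -/
def Face (R : RotationSystem G) : Type _ :=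
  Quotient (Equiv.Perm.SameCycle.setoid R.facePerm)

/-- The face on a fixed side of a dart. The edge of `d` lies on the boundary of `R.face d` and of
`R.face d.symm`. -/
def face (R : RotationSystem G) (d : G.Dart) : R.Face :=
  Quotient.mk _ d

/-- A vertex is incident with a face if the boundary walk of the face passes through it. -/
def Incident (R : RotationSystem G) (x : V) (F : R.Face) : Prop :=
  ∃ d : G.Dart, d.fst = x ∧ R.face d = F

/-- The embedding has genus zero, by Euler's formula, each component being counted on a sphere of its
own. An isolated vertex has no darts, so the one face around it is counted separately. -/
def IsPlane (R : RotationSystem G) : Prop :=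
  Nat.card V + (Nat.card R.Face + {x : V | ∀ y, ¬ G.Adj x y}.ncard) =
    G.edgeSet.ncard + 2 * Nat.card G.ConnectedComponent

/-- `R.IsDualWalk F l F'`: `l` is a walk from `F` to `F'` in the dual (multi)graph. The vertices of
the dual are the faces, and the dual of the edge of a dart `d` joins `R.face d` to `R.face d.symm`;
traversing it in this direction is recorded by `d`. -/
def IsDualWalk (R : RotationSystem G) : R.Face → List G.Dart → R.Face → Prop
  | F, [], F' => F = F'
  | F, d :: l, F' => R.face d = F ∧ R.IsDualWalk (R.face d.symm) l F'

/-- A dual path is a dual walk that visits no face twice. -/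
def IsDualPath (R : RotationSystem G) (F : R.Face) (l : List G.Dart) (F' : R.Face) : Prop :=
  R.IsDualWalk F l F' ∧ (F :: l.map fun d => R.face d.symm).Nodup

/-- The length of a dual walk, where the dual of an edge `e` has the weight `w e`. -/
def dualLength (w : Sym2 V → ℕ) (l : List G.Dart) : ℕ :=
  (l.map fun d => w d.edge).sum

/-- The distance between two faces in the weighted dual graph. -/
noncomputable def faceDist (R : RotationSystem G) (w : Sym2 V → ℕ) (F F' : R.Face) : ℕ :=
  sInf {n | ∃ l, R.IsDualWalk F l F' ∧ dualLength w l = n}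

/-- The distance from a vertex `x` to a face `F`: the least distance to `F` from a face that is
incident with `x`. -/
noncomputable def vertexDist (R : RotationSystem G) (w : Sym2 V → ℕ) (x : V) (F : R.Face) : ℕ :=
  sInf {n | ∃ F', R.Incident x F' ∧ R.faceDist w F' F = n}

/-- The weights are balanced between `F` and `F'` if the dual of every edge lies on a shortest dual
path from `F` to `F'`. -/
def IsBalanced (R : RotationSystem G) (w : Sym2 V → ℕ) (F F' : R.Face) : Prop :=
  ∀ e ∈ G.edgeSet, ∃ l : List G.Dart, R.IsDualPath F l F' ∧
    dualLength w l = R.faceDist w F F' ∧ ∃ d ∈ l, d.edge = e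

theorem pow_rot_fst (R : RotationSystem G) (n : ℕ) (d : G.Dart) :
    ((R.rot ^ n) d).fst = d.fst := by
  induction n with
  | zero => rfl
  | succ n ih => rw [pow_succ', Equiv.Perm.mul_apply, R.rot_fst, ih]

section Restrict

variable {W : Type*} {K : SimpleGraph W}

/-- The dart of the larger graph that corresponds to a dart of the smaller one. -/
def dartMap (f : Copy K G) (d : K.Dart) : G.Dart := f.toHom.mapDart d

theorem dartMap_injective (f : Copy K G) : Function.Injective (dartMap f) := by
  intro d e h
  have h1 : f.toHom d.fst = f.toHom e.fst := congrArg (fun x : G.Dart => x.fst) h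
  have h2 : f.toHom d.snd = f.toHom e.snd := congrArg (fun x : G.Dart => x.snd) h
  exact Dart.ext _ _ (Prod.ext (f.injective h1) (f.injective h2))

variable [Finite V]

theorem finite_dart : Finite G.Dart :=
  Finite.of_injective (fun d : G.Dart => d.toProd) (fun _ _ h => Dart.ext _ _ h)

theorem exists_return (R : RotationSystem G) (f : Copy K G) (d : K.Dart) :
    ∃ n, 0 < n ∧ ∃ d' : K.Dart, (R.rot ^ n) (dartMap f d) = dartMap f d' := by
  have := finite_dart (G := G)
  exact ⟨orderOf R.rot, orderOf_pos _, d, by rw [pow_orderOf_eq_one]; rfl⟩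

open Classical in
/-- How many steps of the rotation lead from a dart of the subgraph to the next one. -/
noncomputable def returnTime (R : RotationSystem G) (f : Copy K G) (d : K.Dart) : ℕ :=
  Nat.find (R.exists_return f d)

theorem returnTime_pos (R : RotationSystem G) (f : Copy K G) (d : K.Dart) :
    0 < R.returnTime f d := by
  classical exact (Nat.find_spec (R.exists_return f d)).1

theorem returnTime_le (R : RotationSystem G) (f : Copy K G) (d d' : K.Dart) (n : ℕ) (hn : 0 < n)
    (h : (R.rot ^ n) (dartMap f d) = dartMap f d') : R.returnTime f d ≤ n := by
  classical exact Nat.find_min' (R.exists_return f d) ⟨hn, d', h⟩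

theorem exists_next (R : RotationSystem G) (f : Copy K G) (d : K.Dart) :
    ∃ d' : K.Dart, (R.rot ^ R.returnTime f d) (dartMap f d) = dartMap f d' := by
  classical exact (Nat.find_spec (R.exists_return f d)).2

/-- The first dart of the subgraph that follows `d` in the rotation of the larger graph. -/
noncomputable def next (R : RotationSystem G) (f : Copy K G) (d : K.Dart) : K.Dart :=
  (R.exists_next f d).choose

theorem next_spec (R : RotationSystem G) (f : Copy K G) (d : K.Dart) :
    (R.rot ^ R.returnTime f d) (dartMap f d) = dartMap f (R.next f d) :=
  (R.exists_next f d).choose_spec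

theorem next_injective (R : RotationSystem G) (f : Copy K G) : Function.Injective (R.next f) := by
  have key : ∀ d e, R.next f d = R.next f e → R.returnTime f d ≤ R.returnTime f e → d = e := by
    intro d e h hle
    have h1 := R.next_spec f d
    rw [h, ← R.next_spec f e] at h1
    obtain ⟨k, hk⟩ := Nat.exists_eq_add_of_le hle
    rw [hk, pow_add, Equiv.Perm.mul_apply] at h1
    have h2 := (R.rot ^ R.returnTime f d).injective h1
    rcases Nat.eq_zero_or_pos k with h0 | h0
    · subst h0
      exact dartMap_injective f h2
    · have h3 := R.returnTime_le f e d k h0 h2.symm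
      have h4 := R.returnTime_pos f d
      omega
  intro d e h
  rcases le_total (R.returnTime f d) (R.returnTime f e) with hle | hle
  · exact key d e h hle
  · exact (key e d h.symm hle).symm

theorem next_bijective (R : RotationSystem G) (f : Copy K G) : Function.Bijective (R.next f) := by
  have := finite_dart (G := G)
  have := Finite.of_injective _ (dartMap_injective f)
  exact Finite.injective_iff_bijective.mp (R.next_injective f)

/-- The embedding of a subgraph that is induced by an embedding of the whole graph: around each
vertex, the remaining darts keep their cyclic order. -/
noncomputable def restrict (R : RotationSystem G) (f : Copy K G) : RotationSystem K where
  rot := Equiv.ofBijective (R.next f) (R.next_bijective f)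
  rot_fst d := by
    have h := congrArg (fun x : G.Dart => x.fst) (R.next_spec f d)
    simp only [pow_rot_fst] at h
    exact (f.injective h).symm
  sameCycle d e hde := by
    have := finite_dart (G := G)
    have hs : R.rot.SameCycle (dartMap f d) (dartMap f e) :=
      R.sameCycle _ _ (congrArg f.toHom hde)
    obtain ⟨k, hk⟩ := hs.exists_nat_pow_eq
    clear hde hs
    induction k using Nat.strong_induction_on generalizing d with
    | _ k ih =>
      rcases Nat.eq_zero_or_pos k with h0 | h0
      · subst h0
        rw [dartMap_injective f hk]
      · obtain ⟨j, hj⟩ := Nat.exists_eq_add_of_le (R.returnTime_le f d e k h0 hk)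
        have hp := R.returnTime_pos f d
        rw [hj, add_comm, pow_add, Equiv.Perm.mul_apply, R.next_spec f d] at hk
        have h1 := ih j (by omega) (R.next f d) hk
        refine Equiv.Perm.SameCycle.trans ?_ h1
        exact ⟨1, rfl⟩

end Restrict

end RotationSystem

/-- A graph is planar if it has a combinatorial embedding of genus zero. -/
def IsPlanar {V : Type*} (G : SimpleGraph V) : Prop :=
  ∃ R : RotationSystem G, R.IsPlane

/-- `G - {u, v}` as a subgraph of `G - uv`. -/
def deleteEndsCopy {V : Type*} (G : SimpleGraph V) (u v : V) :
    Copy (G.induce {u, v}ᶜ) (G.deleteEdges {s(u, v)}) where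
  toHom :=
    { toFun := Subtype.val
      map_rel' := by
        intro x y h
        refine deleteEdges_adj.mpr ⟨h, fun he => ?_⟩
        have hx : (x : V) ∈ s(u, v) := by
          rw [← Set.mem_singleton_iff.mp he]
          exact Sym2.mem_mk_left _ _
        rcases Sym2.mem_iff.mp hx with h1 | h1
        · exact x.2 (Or.inl h1)
        · exact x.2 (Or.inr h1) }
  injective' := Subtype.val_injective

end SimpleGraph

/-!
By Euler's formula, every antisymmetric function on the darts of a connected plane graph that has
zero sum along all faces is the coboundary of a function on the vertices. This takes the place of
the Jordan curve theorem.

As `G` is not planar, no face of `G - uv` is incident with both `u` and `v`. Hence deleting `u` and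
`v` merges the faces around each of them into one face, `Fu` and `Fv`, and `Fu ≠ Fv`. As the graph
`G - {u, v}` is 2-connected, its dual stays connected when a face is removed, and so has a numbering
in which every face other than `Fu` and `Fv` has both a smaller and a larger neighbour. If every
edge has as weight the difference of the numbers on its two sides, then increasing dual paths are
shortest, and every dual edge lies on an increasing path from `Fu` to `Fv`.

The vertex `uᵢ` has degree two in `G - {u, v}`, so it is incident with `Fu` and one other face `Uᵢ`.
Internal 3-connectivity makes the faces `Uᵢ` distinct, and this is all that is needed to choose
positive coefficients for which (3) and (4) hold. Finally a large multiple of the weights on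
`G - {u, v}` satisfies (2) and (7), while the other conditions are homogeneous in these weights.
-/

section Permutations

variable {α : Type*} {σ : Equiv.Perm α} {d e t y : α}

/-- The points of the cycle of `d` that precede `e` when the cycle is traversed from `d`. If `e` is
not in this cycle, this is the whole cycle. -/
def cycleArc (σ : Equiv.Perm α) (d e : α) : Set α :=
  {y | ∃ i : ℕ, (σ ^ i) d = y ∧ ∀ j ≤ i, (σ ^ j) d ≠ e}

theorem left_mem_cycleArc (h : d ≠ e) : d ∈ cycleArc σ d e :=
  ⟨0, rfl, fun j hj => by rwa [Nat.le_zero.mp hj]⟩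

theorem right_notMem_cycleArc : e ∉ cycleArc σ d e :=
  fun ⟨i, hi, h⟩ => h i le_rfl hi

theorem sameCycle_of_mem_cycleArc (hy : y ∈ cycleArc σ d e) : σ.SameCycle d y := by
  obtain ⟨i, rfl, -⟩ := hy
  exact ⟨i, rfl⟩

theorem apply_mem_cycleArc (hy : y ∈ cycleArc σ d e) (hne : σ y ≠ e) : σ y ∈ cycleArc σ d e := by
  obtain ⟨i, rfl, h⟩ := hy
  rw [← Equiv.Perm.mul_apply, ← pow_succ'] at hne ⊢
  exact ⟨i + 1, rfl, fun j hj => hj.lt_or_eq.elim (fun hj => h j (Nat.lt_succ_iff.mp hj))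
    fun hj => hj ▸ hne⟩

theorem apply_mem_cycleArc_iff (hd : σ y ≠ d) (he : σ y ≠ e) :
    σ y ∈ cycleArc σ d e ↔ y ∈ cycleArc σ d e := by
  refine ⟨fun ⟨i, hi, h⟩ => ?_, fun hy => apply_mem_cycleArc hy he⟩
  cases i with
  | zero => exact absurd hi.symm hd
  | succ i =>
    rw [pow_succ'] at hi
    exact ⟨i, σ.injective hi, fun j hj => h j (hj.trans i.le_succ)⟩

variable [Finite α]

theorem mem_of_sameCycle {s : Set α} (hs : ∀ x ∈ s, σ x ∈ s) {x y : α} (h : σ.SameCycle x y)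
    (hx : x ∈ s) : y ∈ s := by
  obtain ⟨n, rfl⟩ := h.exists_nat_pow_eq
  induction n with
  | zero => exact hx
  | succ n ih =>
    rw [pow_succ', Equiv.Perm.mul_apply]
    exact hs _ (ih ⟨n, rfl⟩)

theorem eq_of_sameCycle {β : Type*} {f : α → β} (hf : ∀ x, f (σ x) = f x) {x y : α}
    (h : σ.SameCycle x y) : f y = f x :=
  mem_of_sameCycle (s := {y | f y = f x}) (fun z hz => (hf z).trans hz) h rfl

/-- Otherwise the arc would be mapped into itself and contain `e`. -/
theorem mem_cycleArc_of_apply_eq_right (h : σ.SameCycle d e) (hne : d ≠ e) (hy : σ y = e) :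
    y ∈ cycleArc σ d e := by
  by_contra hyA
  refine right_notMem_cycleArc (σ := σ)
    (mem_of_sameCycle (fun x hx => ?_) h (left_mem_cycleArc hne))
  refine apply_mem_cycleArc hx fun hxe => hyA ?_
  rwa [σ.injective (hy.trans hxe.symm)]

/-- Otherwise the part of the arc up to `y` would be mapped into itself and contain `e`. -/
theorem notMem_cycleArc_of_apply_eq_left (h : σ.SameCycle d e) (hy : σ y = d) :
    y ∉ cycleArc σ d e := by
  rintro ⟨i, rfl, hi⟩
  have hclosed : ∀ x ∈ {x | ∃ j ≤ i, (σ ^ j) d = x}, σ x ∈ {x | ∃ j ≤ i, (σ ^ j) d = x} := by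
    rintro _ ⟨j, hj, rfl⟩
    rcases hj.lt_or_eq with hj | rfl
    · exact ⟨j + 1, hj, by rw [pow_succ', Equiv.Perm.mul_apply]⟩
    · exact ⟨0, Nat.zero_le _, hy.symm⟩
  obtain ⟨j, hj, hje⟩ := mem_of_sameCycle hclosed h ⟨0, Nat.zero_le _, rfl⟩
  exact hi j hj hje

theorem indicator_cycleArc_sub [DecidableEq α] (h : σ.SameCycle d e) (y : α) :
    (cycleArc σ d e).indicator (1 : α → ℝ) y - (cycleArc σ d e).indicator 1 (σ y) =
      (if σ y = e then 1 else 0) - (if σ y = d then 1 else 0) := by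
  rcases eq_or_ne d e with rfl | hde
  · have hempty : cycleArc σ d d = ∅ :=
      Set.eq_empty_of_forall_notMem fun _ ⟨i, _, hi⟩ => hi 0 i.zero_le rfl
    simp [hempty]
  by_cases hd : σ y = d
  · simp [hd, hde, notMem_cycleArc_of_apply_eq_left h hd, left_mem_cycleArc hde]
  by_cases he : σ y = e
  · simp [he, hde.symm, mem_cycleArc_of_apply_eq_right h hde he, right_notMem_cycleArc]
  · classical
    rw [if_neg hd, if_neg he, Set.indicator_apply, Set.indicator_apply,
      apply_mem_cycleArc_iff hd he, Pi.one_apply, Pi.one_apply, sub_self, sub_self]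

end Permutations

theorem forall_of_adj {V : Type*} {G : SimpleGraph V} (hc : G.Connected) {P : V → Prop} {x : V}
    (hx : P x) (h : ∀ y z, G.Adj y z → P y → P z) (y : V) : P y := by
  obtain ⟨w⟩ := hc.preconnected x y
  induction w with
  | nil => exact hx
  | cons hadj _ ih => exact ih (h _ _ hadj hx)

namespace SimpleGraph.RotationSystem

variable {V : Type*} {G : SimpleGraph V}

section Basic

theorem facePerm_apply (R : RotationSystem G) (d : G.Dart) : R.facePerm d = R.rot d.symm := rfl

theorem facePerm_fst (R : RotationSystem G) (d : G.Dart) : (R.facePerm d).fst = d.snd := by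
  rw [facePerm_apply, R.rot_fst]; rfl

theorem face_eq_iff (R : RotationSystem G) {d e : G.Dart} :
    R.face d = R.face e ↔ R.facePerm.SameCycle d e := Quotient.eq

theorem face_facePerm (R : RotationSystem G) (d : G.Dart) : R.face (R.facePerm d) = R.face d :=
  R.face_eq_iff.mpr (Equiv.Perm.SameCycle.symm ⟨1, rfl⟩)

theorem face_rot (R : RotationSystem G) (d : G.Dart) : R.face (R.rot d) = R.face d.symm := by
  have := R.face_facePerm d.symm
  rwa [facePerm_apply, Dart.symm_symm] at this

theorem face_surjective (R : RotationSystem G) : Function.Surjective R.face :=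
  Quotient.mk_surjective

theorem finite_face [Finite V] (R : RotationSystem G) : Finite R.Face :=
  have := finite_dart (G := G)
  Finite.of_surjective _ R.face_surjective

theorem forall_dart_of_connected [Finite V] (R : RotationSystem G) (hc : G.Connected)
    {P : G.Dart → Prop} {d : G.Dart} (hd : P d) (hsymm : ∀ d, P d → P d.symm)
    (hrot : ∀ d, P d → P (R.rot d)) (e : G.Dart) : P e := by
  have := finite_dart (G := G)
  have star : ∀ d e : G.Dart, d.fst = e.fst → P d → P e := fun d e h hd =>
    mem_of_sameCycle (s := {d | P d}) hrot (R.sameCycle d e h) hd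
  refine forall_of_adj hc (P := fun x => ∀ e : G.Dart, e.fst = x → P e) (x := d.fst)
    (fun e he => star d e he.symm hd) ?_ e.fst e rfl
  intro y z hyz hy e he
  exact star _ e he.symm (hsymm _ (hy ⟨(y, z), hyz⟩ rfl))

theorem not_isolated_of_connected [Nonempty G.Dart] (hc : G.Connected) :
    {x : V | ∀ y, ¬ G.Adj x y} = ∅ := by
  rw [Set.eq_empty_iff_forall_notMem]
  intro x hx
  obtain ⟨d⟩ := ‹Nonempty G.Dart›
  refine forall_of_adj hc (P := fun y => ∃ z, G.Adj y z) (x := d.fst) ⟨_, d.adj⟩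
    (fun y z h _ => ⟨y, h.symm⟩) x |>.elim hx

theorem isPlane_iff_of_connected [Nonempty G.Dart] (R : RotationSystem G) (hc : G.Connected) :
    R.IsPlane ↔ Nat.card V + Nat.card R.Face = G.edgeSet.ncard + 2 := by
  have hcomp : Nat.card G.ConnectedComponent = 1 := by
    have := hc.preconnected.subsingleton_connectedComponent
    have := hc.nonempty.map G.connectedComponentMk
    exact Nat.card_unique
  rw [IsPlane, hcomp, not_isolated_of_connected hc, Set.ncard_empty, add_zero, mul_one]

end Basic

section Homology

variable (R : RotationSystem G)

/-- The coboundary of a vertex function plus the boundary of a face function, as functions on the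
darts: the two non-harmonic parts of the discrete Hodge decomposition. -/
def hodgeMap : (V → ℝ) × (R.Face → ℝ) →ₗ[ℝ] (G.Dart → ℝ) where
  toFun x d := (x.1 d.snd - x.1 d.fst) + (x.2 (R.face d) - x.2 (R.face d.symm))
  map_add' x y := by ext d; simp only [Prod.fst_add, Prod.snd_add, Pi.add_apply]; ring
  map_smul' c x := by
    ext d
    simp only [Prod.smul_fst, Prod.smul_snd, Pi.smul_apply, smul_eq_mul, RingHom.id_apply]; ring

theorem hodgeMap_apply (q : V → ℝ) (p : R.Face → ℝ) (d : G.Dart) :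
    R.hodgeMap (q, p) d = (q d.snd - q d.fst) + (p (R.face d) - p (R.face d.symm)) := rfl

/-- The real 1-chains of `G`, encoded as the functions on darts that change sign when a dart is
reversed. -/
def antisymm (G : SimpleGraph V) : Submodule ℝ (G.Dart → ℝ) where
  carrier := {z | ∀ d, z d.symm = - z d}
  add_mem' ha hb d := by
    simp only [Set.mem_ofPred_eq] at ha hb
    simp only [Pi.add_apply, ha, hb]; ring
  zero_mem' d := by simp only [Pi.zero_apply, neg_zero]
  smul_mem' c z hz d := by
    simp only [Set.mem_ofPred_eq] at hz
    simp only [Pi.smul_apply, hz, smul_eq_mul]; ring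

theorem range_hodgeMap_le : LinearMap.range R.hodgeMap ≤ antisymm G := by
  rintro _ ⟨⟨q, p⟩, rfl⟩ d
  rw [hodgeMap_apply, hodgeMap_apply, Dart.symm_symm]
  change (q d.fst - q d.snd) + _ = _
  ring

theorem finrank_antisymm_le [Finite V] :
    Module.finrank ℝ (antisymm G) ≤ G.edgeSet.ncard := by
  classical
  have hex : ∀ e : G.edgeSet, ∃ d : G.Dart, d.edge = e := by
    rintro ⟨e, he⟩
    induction e with
    | _ x y => exact ⟨⟨(x, y), he⟩, rfl⟩
  choose orientation horientation using hex
  let evalOriented : antisymm G →ₗ[ℝ] (G.edgeSet → ℝ) :=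
    { toFun := fun z e => z.1 (orientation e)
      map_add' := fun _ _ => rfl
      map_smul' := fun _ _ => rfl }
  have hinj : Function.Injective evalOriented := by
    rw [← LinearMap.ker_eq_bot, LinearMap.ker_eq_bot']
    intro z hz
    ext d
    have h : z.1 (orientation ⟨d.edge, d.edge_mem⟩) = 0 := congrFun hz ⟨d.edge, d.edge_mem⟩
    rcases (dart_edge_eq_iff _ _).mp (horientation ⟨d.edge, d.edge_mem⟩) with h' | h'
    · rw [h'] at h; exact h
    · rw [h', z.2 d, neg_eq_zero] at h; exact h
  have : Fintype G.edgeSet := Fintype.ofFinite _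
  have h := LinearMap.finrank_le_finrank_of_injective hinj
  rwa [Module.finrank_fintype_fun_eq_card, ← Nat.card_eq_fintype_card] at h

section Sums

variable [Fintype G.Dart]

theorem sum_dart_symm (f : G.Dart → ℝ) : ∑ d : G.Dart, f d.symm = ∑ d, f d :=
  Equiv.sum_comp (Function.Involutive.toPerm Dart.symm Dart.symm_involutive) f

theorem sum_antisymm_mul_symm {z : G.Dart → ℝ} (hz : z ∈ antisymm G) (f : G.Dart → ℝ) :
    ∑ d, z d * f d.symm = -∑ d, z d * f d := by
  rw [← sum_dart_symm, ← Finset.sum_neg_distrib]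
  refine Finset.sum_congr rfl fun d _ => ?_
  rw [hz d, Dart.symm_symm, neg_mul]

open Classical in
theorem sum_face_facePerm (f : G.Dart → ℝ) (F : R.Face) :
    ∑ d with R.face d = F, f (R.facePerm d) = ∑ d with R.face d = F, f d := by
  rw [Finset.sum_filter, Finset.sum_filter,
    ← Equiv.sum_comp R.facePerm (fun d => if R.face d = F then f d else 0)]
  simp only [face_facePerm]

open Classical in
theorem sum_face_single_sub (c c' : G.Dart) (F : R.Face) :
    ∑ y with R.face y = F, ((if y = c then (1 : ℝ) else 0) - (if y = c' then 1 else 0)) =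
      (if R.face c = F then 1 else 0) - (if R.face c' = F then 1 else 0) := by
  simp only [Finset.sum_sub_distrib, Finset.sum_ite_eq', Finset.mem_filter, Finset.mem_univ,
    true_and]

open Classical in
theorem sum_mul_boundary_eq_zero [Finite R.Face] {z : G.Dart → ℝ} (hz : z ∈ antisymm G)
    (hF : ∀ F, ∑ d with R.face d = F, z d = 0) (p : R.Face → ℝ) :
    ∑ d, z d * (p (R.face d) - p (R.face d.symm)) = 0 := by
  have : Fintype R.Face := Fintype.ofFinite _
  have hzp : ∑ d, z d * p (R.face d) = 0 := by
    rw [← Finset.sum_fiberwise (s := Finset.univ) (g := R.face)]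
    refine Finset.sum_eq_zero fun F _ => ?_
    rw [← zero_mul (p F), ← hF F, Finset.sum_mul]
    refine Finset.sum_congr rfl fun d hd => ?_
    rw [(Finset.mem_filter.mp hd).2]
  simp only [mul_sub, Finset.sum_sub_distrib, sum_antisymm_mul_symm hz fun d => p (R.face d), hzp,
    neg_zero, sub_self]

open Classical in
theorem sum_face_coboundary (q : V → ℝ) (F : R.Face) :
    ∑ d with R.face d = F, (q d.snd - q d.fst) = 0 := by
  have h := R.sum_face_facePerm (fun d => q d.fst) F
  simp only [facePerm_fst] at h
  rw [Finset.sum_sub_distrib, h, sub_self]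

/-- Multiplying the hypothesis by the boundary of `p` leaves the sum of the squares of the
latter. -/
theorem boundary_eq_zero_of_sum_mul_eq_zero {z : G.Dart → ℝ} {q : V → ℝ} {p : R.Face → ℝ}
    [Finite R.Face] (hqp : R.hodgeMap (q, p) = z)
    (hz : ∑ d, z d * (p (R.face d) - p (R.face d.symm)) = 0) (d : G.Dart) :
    p (R.face d) - p (R.face d.symm) = 0 := by
  classical
  have hcoboundary : (fun d : G.Dart => q d.snd - q d.fst) ∈ antisymm G := fun d => by
    change q d.fst - q d.snd = -(q d.snd - q d.fst)
    ring
  have hsq : ∑ d : G.Dart, (p (R.face d) - p (R.face d.symm)) ^ 2 = 0 := by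
    rw [← hz, ← sub_eq_zero, ← neg_eq_zero, ← Finset.sum_sub_distrib, ← Finset.sum_neg_distrib,
      ← R.sum_mul_boundary_eq_zero hcoboundary (R.sum_face_coboundary q) p]
    refine Finset.sum_congr rfl fun d _ => ?_
    rw [← hqp, hodgeMap_apply]; ring
  exact pow_eq_zero_iff two_ne_zero |>.mp <|
    (Finset.sum_eq_zero_iff_of_nonneg fun d _ => sq_nonneg _).mp hsq d (Finset.mem_univ d)

end Sums

variable [Finite V]

theorem eq_of_hodgeMap_eq_zero {q : V → ℝ} {p : R.Face → ℝ}
    (h : R.hodgeMap (q, p) = 0) (d : G.Dart) :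
    q d.snd = q d.fst ∧ p (R.face d) = p (R.face d.symm) := by
  have := finite_dart (G := G)
  have : Fintype G.Dart := Fintype.ofFinite _
  have := R.finite_face
  have hp := R.boundary_eq_zero_of_sum_mul_eq_zero h
    (by simp only [Pi.zero_apply, zero_mul, Finset.sum_const_zero]) d
  have hd : R.hodgeMap (q, p) d = 0 := congrFun h d
  rw [hodgeMap_apply, hp, add_zero] at hd
  exact ⟨sub_eq_zero.mp hd, sub_eq_zero.mp hp⟩

variable [Nonempty G.Dart]

theorem finrank_ker_hodgeMap_le (hc : G.Connected) :
    Module.finrank ℝ (LinearMap.ker R.hodgeMap) ≤ 2 := by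
  have := R.finite_face
  obtain ⟨d₀⟩ := ‹Nonempty G.Dart›
  let evalBase : LinearMap.ker R.hodgeMap →ₗ[ℝ] ℝ × ℝ :=
    { toFun := fun x => (x.1.1 d₀.fst, x.1.2 (R.face d₀))
      map_add' := fun _ _ => rfl
      map_smul' := fun _ _ => rfl }
  have hinj : Function.Injective evalBase := by
    rw [← LinearMap.ker_eq_bot, LinearMap.ker_eq_bot']
    rintro ⟨⟨q, p⟩, hx⟩ hz
    have hd := R.eq_of_hodgeMap_eq_zero (LinearMap.mem_ker.mp hx)
    have hq : ∀ y, q y = 0 := forall_of_adj hc (congrArg Prod.fst hz) fun y z hyz hy =>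
      ((hd ⟨(y, z), hyz⟩).1).trans hy
    have hp : ∀ d, p (R.face d) = 0 := R.forall_dart_of_connected hc (congrArg Prod.snd hz)
      (fun d h => (hd d).2.symm.trans h)
      (fun d h => by rw [face_rot]; exact (hd d).2.symm.trans h)
    refine Subtype.ext (Prod.ext (funext hq) (funext fun F => ?_))
    obtain ⟨d, rfl⟩ := R.face_surjective F
    exact hp d
  have h := LinearMap.finrank_le_finrank_of_injective hinj
  rwa [Module.finrank_prod, Module.finrank_self] at h

theorem card_add_card_face_le_finrank_range (hc : G.Connected) :
    Nat.card V + Nat.card R.Face ≤ Module.finrank ℝ (LinearMap.range R.hodgeMap) + 2 := by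
  have := R.finite_face
  have : Fintype V := Fintype.ofFinite V
  have : Fintype R.Face := Fintype.ofFinite _
  have h := LinearMap.finrank_range_add_finrank_ker R.hodgeMap
  rw [Module.finrank_prod, Module.finrank_fintype_fun_eq_card,
    Module.finrank_fintype_fun_eq_card, ← Nat.card_eq_fintype_card,
    ← Nat.card_eq_fintype_card] at h
  have := R.finrank_ker_hodgeMap_le hc
  omega

theorem card_add_card_face_le (hc : G.Connected) :
    Nat.card V + Nat.card R.Face ≤ G.edgeSet.ncard + 2 := by
  have := finite_dart (G := G)
  refine (R.card_add_card_face_le_finrank_range hc).trans ?_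
  have := Submodule.finrank_mono R.range_hodgeMap_le
  have := finrank_antisymm_le (G := G)
  omega

open Classical in
/-- The first homology of the sphere vanishes: equality in Euler's inequality makes `hodgeMap`
surjective onto the 1-chains, and the boundary part of a face-balanced chain, one with zero sum
along every face, is zero. -/
theorem IsPlane.exists_potential [Fintype G.Dart] {R : RotationSystem G} (hR : R.IsPlane)
    (hc : G.Connected) {z : G.Dart → ℝ} (hz : z ∈ antisymm G)
    (hF : ∀ F, ∑ d with R.face d = F, z d = 0) :
    ∃ q : V → ℝ, ∀ d : G.Dart, z d = q d.snd - q d.fst := by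
  have := R.finite_face
  rw [isPlane_iff_of_connected R hc] at hR
  have hrange : LinearMap.range R.hodgeMap = antisymm G := by
    refine Submodule.eq_of_le_of_finrank_le R.range_hodgeMap_le ?_
    have := R.card_add_card_face_le_finrank_range hc
    have := finrank_antisymm_le (G := G)
    omega
  obtain ⟨⟨q, p⟩, hqp⟩ : z ∈ LinearMap.range R.hodgeMap := hrange ▸ hz
  refine ⟨q, fun d => ?_⟩
  rw [← congrFun hqp d, hodgeMap_apply, R.boundary_eq_zero_of_sum_mul_eq_zero hqp
    (R.sum_mul_boundary_eq_zero hz hF p) d, add_zero]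

end Homology

end SimpleGraph.RotationSystem

namespace SimpleGraph.IsVertexConnected

variable {V : Type*} {G : SimpleGraph V}

theorem connected {k : ℕ} (h : G.IsVertexConnected k) (hk : 0 < k) : G.Connected := by
  have h0 := h.2 ∅ (by rwa [Set.ncard_empty])
  rw [Set.compl_empty] at h0
  exact (induceUnivIso G).connected_iff.mp h0

theorem forall_of_adj_of_ne (h : G.IsVertexConnected 2) {x : V} {P : V → Prop} {y : V}
    (hyx : y ≠ x) (hy : P y) (hP : ∀ y z, y ≠ x → z ≠ x → G.Adj y z → P y → P z) {z : V}
    (hzx : z ≠ x) : P z := by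
  have hc := h.2 {x} (by rw [Set.ncard_singleton]; exact one_lt_two)
  exact forall_of_adj hc (P := fun a => P a.1) (x := ⟨y, hyx⟩) hy
    (fun a b hab ha => hP a b a.2 b.2 hab ha) ⟨z, hzx⟩

theorem exists_ne_ne (h : G.IsVertexConnected 2) (x y : V) : ∃ z, z ≠ x ∧ z ≠ y := by
  have hne : ({x, y} : Set V) ≠ Set.univ := fun huniv => by
    have hcard := h.1
    rw [← Set.ncard_univ, ← huniv] at hcard
    exact hcard.not_ge (by
      simpa only [Set.ncard_singleton] using Set.ncard_insert_le x {y})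
  obtain ⟨z, hz⟩ := (Set.ne_univ_iff_exists_notMem _).mp hne
  rw [Set.mem_insert_iff, Set.mem_singleton_iff, not_or] at hz
  exact ⟨z, hz⟩

theorem exists_adj_ne (h : G.IsVertexConnected 2) (x y : V) : ∃ z, z ≠ y ∧ G.Adj x z := by
  by_contra! hno
  obtain ⟨w, hwx, hwy⟩ := h.exists_ne_ne x y
  by_cases hxy : x = y
  · subst hxy
    refine hwx (forall_of_adj (h.connected two_pos) (P := fun a => a = x) rfl ?_ w)
    rintro a b hab rfl
    exact absurd hab (hno b hab.ne')
  · refine hwx (h.forall_of_adj_of_ne (P := fun a => a = x) hxy rfl ?_ hwy)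
    rintro a b _ hb hab rfl
    exact absurd hab (hno b hb)

theorem nonempty_dart (h : G.IsVertexConnected 2) : Nonempty G.Dart := by
  obtain ⟨x⟩ := (h.connected two_pos).nonempty
  obtain ⟨z, _, hz⟩ := h.exists_adj_ne x x
  exact ⟨⟨(x, z), hz⟩⟩

end SimpleGraph.IsVertexConnected

namespace SimpleGraph.RotationSystem

variable {V : Type*} {G : SimpleGraph V}

section TwoConnected

variable [Finite V] {R : RotationSystem G}

open Classical in
/-- A potential of the chain is constant on the connected graph `G - x`. -/
theorem IsPlane.eq_of_supported_on_star [Fintype G.Dart] (hR : R.IsPlane)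
    (h2 : G.IsVertexConnected 2) {z : G.Dart → ℝ} (hz : z ∈ antisymm G)
    (hF : ∀ F, ∑ d with R.face d = F, z d = 0) {x : V}
    (hx : ∀ d : G.Dart, d.fst ≠ x → d.snd ≠ x → z d = 0) {d e : G.Dart}
    (hd : d.fst = x) (he : e.fst = x) : z d = z e := by
  have := h2.nonempty_dart
  obtain ⟨q, hq⟩ := hR.exists_potential (h2.connected two_pos) hz hF
  have hde : q e.snd = q d.snd := by
    refine h2.forall_of_adj_of_ne (x := x) (P := fun y => q y = q d.snd) (y := d.snd)
      (hd ▸ d.adj.ne') rfl ?_ (he ▸ e.adj.ne')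
    intro y z hy hz hyz h
    have h0 := hx ⟨(y, z), hyz⟩ hy hz
    rw [hq] at h0
    exact (sub_eq_zero.mp h0).trans h
  rw [hq, hq, hde, hd, he]

open Classical in
theorem sum_face_cycleArc_rot_eq_zero [Fintype G.Dart] {d e : G.Dart} (hfst : d.fst = e.fst)
    (hface : R.face d = R.face e) (F : R.Face) :
    ∑ y with R.face y = F, ((cycleArc R.rot d e).indicator (1 : G.Dart → ℝ) y -
      (cycleArc R.rot d e).indicator 1 y.symm) = 0 := by
  have := finite_dart (G := G)
  have hstep : ∀ y : G.Dart, (cycleArc R.rot d e).indicator (1 : G.Dart → ℝ) y.symm =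
      (cycleArc R.rot d e).indicator 1 (R.facePerm y) +
        ((if R.facePerm y = e then 1 else 0) - (if R.facePerm y = d then 1 else 0)) := fun y => by
    rw [facePerm_apply, ← indicator_cycleArc_sub (R.sameCycle d e hfst) y.symm]; ring
  simp only [hstep]
  rw [Finset.sum_sub_distrib, Finset.sum_add_distrib, R.sum_face_facePerm,
    R.sum_face_facePerm fun y => (if y = e then (1 : ℝ) else 0) - (if y = d then 1 else 0),
    sum_face_single_sub, hface]
  ring

/-- If `d ≠ e`, the chain that is supported on the arc from `d` to `e` of the star of `d.fst` would
be face-balanced, but not constant on the star. -/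
theorem IsPlane.dart_eq_of_face_eq (hR : R.IsPlane) (h2 : G.IsVertexConnected 2) {d e : G.Dart}
    (hfst : d.fst = e.fst) (hface : R.face d = R.face e) : d = e := by
  classical
  have := finite_dart (G := G)
  have : Fintype G.Dart := Fintype.ofFinite _
  by_contra hne
  have hstar : ∀ y ∈ cycleArc R.rot d e, y.fst = d.fst := fun y hy =>
    eq_of_sameCycle (f := fun y : G.Dart => y.fst) R.rot_fst (sameCycle_of_mem_cycleArc hy)
  have hds : d.symm ∉ cycleArc R.rot d e := fun h => d.adj.ne' (hstar _ h)
  have hes : e.symm ∉ cycleArc R.rot d e := fun h => e.adj.ne' ((hstar _ h).trans hfst)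
  have hval := hR.eq_of_supported_on_star h2
    (z := fun y => (cycleArc R.rot d e).indicator 1 y - (cycleArc R.rot d e).indicator 1 y.symm)
    (fun y => by simp only [Dart.symm_symm, neg_sub]) (sum_face_cycleArc_rot_eq_zero hfst hface)
    (fun y hy hy' => by
      rw [Set.indicator_of_notMem fun h => hy (hstar _ h),
        Set.indicator_of_notMem fun h => hy' (hstar _ h), sub_zero]) rfl hfst.symm
  simp [left_mem_cycleArc hne, right_notMem_cycleArc, hds, hes] at hval

/-- Otherwise the chain that is supported on this edge would be face-balanced. -/
theorem IsPlane.face_symm_ne (hR : R.IsPlane) (h2 : G.IsVertexConnected 2) (d : G.Dart) :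
    R.face d.symm ≠ R.face d := by
  classical
  have := finite_dart (G := G)
  have : Fintype G.Dart := Fintype.ofFinite _
  intro hface
  obtain ⟨y, hy, hxy⟩ := h2.exists_adj_ne d.fst d.snd
  let c : G.Dart := ⟨(d.fst, y), hxy⟩
  have hcd : c ≠ d := fun h => hy (congrArg (fun c : G.Dart => c.snd) h)
  have hcd' : c ≠ d.symm := fun h => d.adj.ne (congrArg (fun c : G.Dart => c.fst) h)
  have hsymm : ∀ y : G.Dart, y.symm = d ↔ y = d.symm := fun y =>
    Dart.symm_involutive.eq_iff
  have hval := hR.eq_of_supported_on_star h2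
    (z := fun y => (if y = d then (1 : ℝ) else 0) - (if y = d.symm then 1 else 0)) (x := d.fst)
    (d := d) (e := c) (fun y => ?_) (fun F => ?_) (fun y hy hy' => ?_) rfl rfl
  · simp [hcd, hcd', d.symm_ne.symm] at hval
  · simp only [hsymm, Dart.symm_involutive.injective.eq_iff]; ring
  · rw [sum_face_single_sub, hface, sub_self]
  · rw [if_neg fun h => hy (by rw [h]), if_neg fun h => hy' (by rw [h]; rfl), sub_zero]

/-- The dual graph without loops and multiplicities of edges. -/
def dualGraph (R : RotationSystem G) : SimpleGraph R.Face where
  Adj F F' := F ≠ F' ∧ ∃ d, R.face d = F ∧ R.face d.symm = F'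
  symm := ⟨fun _ _ ⟨hne, d, h, h'⟩ => ⟨hne.symm, d.symm, h', by rwa [Dart.symm_symm]⟩⟩
  loopless := ⟨fun _ h => h.1 rfl⟩

/-- As `X` has only one corner at the vertex, the other corners there are consecutive. -/
theorem IsPlane.face_mem_iff_of_fst_eq (hR : R.IsPlane) (h2 : G.IsVertexConnected 2) {X : R.Face}
    {S : Set R.Face} (hS : ∀ F F', F ≠ X → F' ≠ X → R.dualGraph.Adj F F' → F ∈ S → F' ∈ S)
    {d e : G.Dart} (hde : d.fst = e.fst) (hd : R.face d ≠ X) (he : R.face e ≠ X) :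
    R.face d ∈ S ↔ R.face e ∈ S := by
  have := finite_dart (G := G)
  have step : ∀ y, R.face y ≠ X → R.face (R.rot y) ≠ X →
      (R.face (R.rot y) ∈ S ↔ R.face y ∈ S) := by
    intro y hy hy'
    have hadj : R.dualGraph.Adj (R.face y) (R.face (R.rot y)) := by
      rw [face_rot]
      exact ⟨(hR.face_symm_ne h2 y).symm, y, rfl, rfl⟩
    exact ⟨hS _ _ hy' hy hadj.symm, hS _ _ hy hy' hadj⟩
  obtain ⟨first, hfirst, hX⟩ : ∃ first : G.Dart, first.fst = d.fst ∧
      ∀ y : G.Dart, y.fst = d.fst → R.face y = X → R.rot y = first := by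
    by_cases hex : ∃ y : G.Dart, y.fst = d.fst ∧ R.face y = X
    · obtain ⟨y, hy, hyX⟩ := hex
      refine ⟨R.rot y, by rw [R.rot_fst, hy], fun y' hy' hyX' => ?_⟩
      rw [hR.dart_eq_of_face_eq h2 (hy.trans hy'.symm) (hyX.trans hyX'.symm)]
    · exact ⟨d, rfl, fun y hy hyX => (hex ⟨y, hy, hyX⟩).elim⟩
  have hclosed : ∀ y : G.Dart, y.fst = d.fst →
      R.face y ≠ X → (R.face y ∈ S ↔ R.face first ∈ S) := fun y hy =>
    (mem_of_sameCycle
      (s := {y | y.fst = d.fst ∧ (R.face y ≠ X → (R.face y ∈ S ↔ R.face first ∈ S))})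
      (fun y ⟨hy, hyS⟩ => ⟨(R.rot_fst y).trans hy, fun hrot => by
        by_cases hyX : R.face y = X
        · rw [hX y hy hyX]
        · exact (step y hyX hrot).trans (hyS hyX)⟩)
      (R.sameCycle first y (hfirst.trans hy.symm)) ⟨hfirst, fun _ => Iff.rfl⟩).2
  exact (hclosed d rfl hd).trans (hclosed e hde.symm he).symm

/-- The dual of a 2-connected plane graph has no cut vertex `X`. -/
theorem IsPlane.forall_face_of_dualAdj (hR : R.IsPlane) (h2 : G.IsVertexConnected 2)
    {X F₀ : R.Face} {S : Set R.Face} (hF₀ : F₀ ≠ X) (hF₀S : F₀ ∈ S)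
    (hS : ∀ F F', F ≠ X → F' ≠ X → R.dualGraph.Adj F F' → F ∈ S → F' ∈ S) {F : R.Face}
    (hF : F ≠ X) : F ∈ S := by
  obtain ⟨d₀, rfl⟩ := R.face_surjective F₀
  obtain ⟨d, rfl⟩ := R.face_surjective F
  have star : ∀ {d e : G.Dart}, e.fst = d.fst → R.face d ≠ X → R.face e ≠ X → R.face e ∈ S →
      R.face d ∈ S := fun h hd he => (hR.face_mem_iff_of_fst_eq h2 hS h he hd).mp
  obtain ⟨e, he, heX, heS⟩ : ∃ e : G.Dart, e.fst = d.fst ∧ R.face e ≠ X ∧ R.face e ∈ S := by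
    refine forall_of_adj (h2.connected two_pos)
      (P := fun x => ∃ e : G.Dart, e.fst = x ∧ R.face e ≠ X ∧ R.face e ∈ S)
      ⟨d₀, rfl, hF₀, hF₀S⟩ ?_ d.fst
    rintro x y hxy ⟨e, rfl, heX, heS⟩
    let c : G.Dart := ⟨(e.fst, y), hxy⟩
    by_cases hc : R.face c.symm = X
    · have hc' : R.face c ≠ X := fun h => hR.face_symm_ne h2 c (hc.trans h.symm)
      refine ⟨R.facePerm c, R.facePerm_fst c, ?_⟩
      rw [face_facePerm]
      exact ⟨hc', star (e := e) rfl hc' heX heS⟩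
    · refine ⟨c.symm, rfl, hc, ?_⟩
      rw [← face_rot] at hc ⊢
      exact star (e := e) (R.rot_fst c).symm hc heX heS
  exact star he hF heX heS

end TwoConnected

end SimpleGraph.RotationSystem

section InsertBefore

variable {α : Type*} [DecidableEq α] {σ : Equiv.Perm α} {t d y : α}

/-- The permutation `σ` with its fixed point `t` inserted immediately before `d` into the cycle of
`d`. -/
def insertBefore (σ : Equiv.Perm α) (t d : α) : Equiv.Perm α := Equiv.swap t d * σ

theorem insertBefore_apply_of_eq (hy : σ y = d) : insertBefore σ t d y = t := by
  rw [insertBefore, Equiv.Perm.mul_apply, hy, Equiv.swap_apply_right]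

theorem insertBefore_apply_self (ht : σ t = t) : insertBefore σ t d t = d := by
  rw [insertBefore, Equiv.Perm.mul_apply, ht, Equiv.swap_apply_left]

theorem insertBefore_apply_of_ne (ht : σ y ≠ t) (hd : σ y ≠ d) : insertBefore σ t d y = σ y :=
  Equiv.swap_apply_of_ne_of_ne ht hd

theorem comp_insertBefore {β : Type*} {f : α → β} (hf : ∀ y, f (σ y) = f y) (h : f t = f d)
    (y : α) : f (insertBefore σ t d y) = f y := by
  rw [← hf y, insertBefore, Equiv.Perm.mul_apply, Equiv.swap_apply_def]
  split_ifs with h1 h2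
  · rw [h1, h]
  · rw [h2, h]
  · rfl

theorem sameCycle_insertBefore [Finite α] (ht : σ t = t) {x y : α} (h : σ.SameCycle x y) :
    (insertBefore σ t d).SameCycle x y := by
  have hstep : ∀ z, (insertBefore σ t d).SameCycle z (σ z) := by
    intro z
    by_cases hzd : σ z = d
    · refine ⟨2, ?_⟩
      rw [zpow_ofNat, pow_two, Equiv.Perm.mul_apply, insertBefore_apply_of_eq hzd,
        insertBefore_apply_self ht, hzd]
    by_cases hzt : σ z = t
    · rw [hzt, σ.injective (hzt.trans ht.symm)]
    · exact ⟨1, insertBefore_apply_of_ne hzt hzd⟩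
  exact mem_of_sameCycle (s := {y | (insertBefore σ t d).SameCycle x y})
    (fun z hz => hz.trans (hstep z)) h .rfl

end InsertBefore

namespace SimpleGraph.RotationSystem

section EdgeInsertion

variable {V : Type*} {G : SimpleGraph V} {u v : V}

/-- `G - uv` as a subgraph of `G`. -/
abbrev deleteEdgeCopy (G : SimpleGraph V) (u v : V) : Copy (G.deleteEdges {s(u, v)}) G :=
  Copy.ofLE _ _ (deleteEdges_le _)

theorem mem_range_dartMap_deleteEdgeCopy {y : G.Dart} :
    y ∈ Set.range (dartMap (deleteEdgeCopy G u v)) ↔ y.edge ≠ s(u, v) := by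
  constructor
  · rintro ⟨x, rfl⟩ h
    exact (deleteEdges_adj.mp x.adj).2 h
  · intro h
    exact ⟨⟨y.toProd, deleteEdges_adj.mpr ⟨y.adj, h⟩⟩, rfl⟩

theorem dartMap_deleteEdgeCopy_ne_uv (huv : G.Adj u v) (x : (G.deleteEdges {s(u, v)}).Dart) :
    dartMap (deleteEdgeCopy G u v) x ≠ ⟨(u, v), huv⟩ := fun h =>
  mem_range_dartMap_deleteEdgeCopy (u := u) (v := v) (y := ⟨(u, v), huv⟩) |>.mp ⟨x, h⟩ rfl

theorem dartMap_deleteEdgeCopy_ne_vu (huv : G.Adj u v) (x : (G.deleteEdges {s(u, v)}).Dart) :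
    dartMap (deleteEdgeCopy G u v) x ≠ ⟨(v, u), huv.symm⟩ := fun h =>
  mem_range_dartMap_deleteEdgeCopy (u := u) (v := v) (y := ⟨(v, u), huv.symm⟩) |>.mp ⟨x, h⟩
    Sym2.eq_swap

theorem dart_deleteEdge_cases (huv : G.Adj u v) (y : G.Dart) :
    y = ⟨(u, v), huv⟩ ∨ y = ⟨(v, u), huv.symm⟩ ∨ ∃ x, dartMap (deleteEdgeCopy G u v) x = y := by
  by_cases h : y.edge = s(u, v)
  · exact ((dart_edge_eq_iff y ⟨(u, v), huv⟩).mp h).imp_right Or.inl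
  · exact Or.inr (Or.inr (mem_range_dartMap_deleteEdgeCopy.mpr h))

variable (M : (G.deleteEdges {s(u, v)}).RotationSystem)

open Classical in
/-- The rotation of `M`, where the darts `uv` and `vu` are fixed points. -/
noncomputable def extendRot : Equiv.Perm G.Dart :=
  M.rot.extendDomain (Equiv.ofInjective _ (dartMap_injective (deleteEdgeCopy G u v)))

theorem extendRot_dartMap (x : (G.deleteEdges {s(u, v)}).Dart) :
    M.extendRot (dartMap (deleteEdgeCopy G u v) x) =
      dartMap (deleteEdgeCopy G u v) (M.rot x) := by
  classical
  exact Equiv.Perm.extendDomain_apply_image M.rot (Equiv.ofInjective _ _) x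

theorem extendRot_of_edge_eq {y : G.Dart} (hy : y.edge = s(u, v)) : M.extendRot y = y := by
  classical
  exact Equiv.Perm.extendDomain_apply_not_subtype M.rot _ fun h =>
    mem_range_dartMap_deleteEdgeCopy.mp h hy

theorem extendRot_fst (y : G.Dart) : (M.extendRot y).fst = y.fst := by
  by_cases hy : y.edge = s(u, v)
  · rw [M.extendRot_of_edge_eq hy]
  · obtain ⟨x, rfl⟩ := mem_range_dartMap_deleteEdgeCopy.mpr hy
    rw [extendRot_dartMap]
    exact M.rot_fst x

variable (huv : G.Adj u v) {d e : (G.deleteEdges {s(u, v)}).Dart}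

open Classical in
/-- The rotation of `M`, extended so that `uv` precedes `d` and `vu` precedes `e`. -/
noncomputable def insertRot (d e : (G.deleteEdges {s(u, v)}).Dart) : Equiv.Perm G.Dart :=
  insertBefore (insertBefore M.extendRot ⟨(u, v), huv⟩ (dartMap (deleteEdgeCopy G u v) d))
    ⟨(v, u), huv.symm⟩ (dartMap (deleteEdgeCopy G u v) e)

theorem insertRot_fst (hd : d.fst = u) (he : e.fst = v) (y : G.Dart) :
    (M.insertRot huv d e y).fst = y.fst := by
  classical
  have hfst : ∀ y, (insertBefore M.extendRot ⟨(u, v), huv⟩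
      (dartMap (deleteEdgeCopy G u v) d) y).fst = y.fst :=
    comp_insertBefore (f := fun y : G.Dart => y.fst) M.extendRot_fst hd.symm
  exact comp_insertBefore (f := fun y : G.Dart => y.fst) hfst he.symm y

theorem uv_dart_ne_vu_dart : (⟨(u, v), huv⟩ : G.Dart) ≠ ⟨(v, u), huv.symm⟩ :=
  fun h => huv.ne (congrArg (fun x : G.Dart => x.fst) h)

open Classical in
theorem insertBefore_extendRot_vu :
    insertBefore M.extendRot ⟨(u, v), huv⟩ (dartMap (deleteEdgeCopy G u v) d)
      ⟨(v, u), huv.symm⟩ = ⟨(v, u), huv.symm⟩ := by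
  have hfix : M.extendRot ⟨(v, u), huv.symm⟩ = ⟨(v, u), huv.symm⟩ :=
    M.extendRot_of_edge_eq Sym2.eq_swap
  refine (insertBefore_apply_of_ne ?_ ?_).trans hfix <;> rw [hfix]
  · exact (uv_dart_ne_vu_dart huv).symm
  · exact (dartMap_deleteEdgeCopy_ne_vu huv d).symm

theorem insertRot_uv (hde : d ≠ e) :
    M.insertRot huv d e ⟨(u, v), huv⟩ = dartMap (deleteEdgeCopy G u v) d := by
  classical
  have hd := insertBefore_apply_self (d := dartMap (deleteEdgeCopy G u v) d)
    (M.extendRot_of_edge_eq (y := ⟨(u, v), huv⟩) rfl)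
  refine (insertBefore_apply_of_ne ?_ ?_).trans hd <;> rw [hd]
  · exact dartMap_deleteEdgeCopy_ne_vu huv d
  · exact (dartMap_injective _).ne hde

theorem insertRot_vu :
    M.insertRot huv d e ⟨(v, u), huv.symm⟩ = dartMap (deleteEdgeCopy G u v) e := by
  classical
  exact insertBefore_apply_self (M.insertBefore_extendRot_vu huv)

theorem insertRot_of_rot_eq_left {x : (G.deleteEdges {s(u, v)}).Dart} (hx : M.rot x = d) :
    M.insertRot huv d e (dartMap (deleteEdgeCopy G u v) x) = ⟨(u, v), huv⟩ := by
  classical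
  have huvx := insertBefore_apply_of_eq (t := (⟨(u, v), huv⟩ : G.Dart))
    ((M.extendRot_dartMap x).trans (congrArg _ hx))
  refine (insertBefore_apply_of_ne ?_ ?_).trans huvx <;> rw [huvx]
  · exact uv_dart_ne_vu_dart huv
  · exact (dartMap_deleteEdgeCopy_ne_uv huv e).symm

open Classical in
theorem insertBefore_extendRot_dartMap {x : (G.deleteEdges {s(u, v)}).Dart} (hx : M.rot x ≠ d) :
    insertBefore M.extendRot ⟨(u, v), huv⟩ (dartMap (deleteEdgeCopy G u v) d)
      (dartMap (deleteEdgeCopy G u v) x) = dartMap (deleteEdgeCopy G u v) (M.rot x) := by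
  refine (insertBefore_apply_of_ne ?_ ?_).trans (M.extendRot_dartMap x) <;>
    rw [extendRot_dartMap]
  · exact dartMap_deleteEdgeCopy_ne_uv huv _
  · exact (dartMap_injective _).ne hx

theorem insertRot_of_rot_eq_right (hde : d ≠ e) {x : (G.deleteEdges {s(u, v)}).Dart}
    (hx : M.rot x = e) :
    M.insertRot huv d e (dartMap (deleteEdgeCopy G u v) x) = ⟨(v, u), huv.symm⟩ := by
  classical
  refine insertBefore_apply_of_eq ?_
  rw [insertBefore_extendRot_dartMap _ _ (hx ▸ hde.symm), hx]

theorem insertRot_of_rot_ne {x : (G.deleteEdges {s(u, v)}).Dart} (hd : M.rot x ≠ d)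
    (he : M.rot x ≠ e) :
    M.insertRot huv d e (dartMap (deleteEdgeCopy G u v) x) =
      dartMap (deleteEdgeCopy G u v) (M.rot x) := by
  classical
  have hx := M.insertBefore_extendRot_dartMap huv hd
  refine (insertBefore_apply_of_ne ?_ ?_).trans hx <;> rw [hx]
  · exact dartMap_deleteEdgeCopy_ne_vu huv _
  · exact (dartMap_injective _).ne he

theorem sameCycle_insertRot_dartMap [Finite V] {x y : (G.deleteEdges {s(u, v)}).Dart}
    (h : x.fst = y.fst) :
    (M.insertRot huv d e).SameCycle (dartMap (deleteEdgeCopy G u v) x)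
      (dartMap (deleteEdgeCopy G u v) y) := by
  classical
  have := finite_dart (G := G)
  exact sameCycle_insertBefore (M.insertBefore_extendRot_vu huv) <|
    sameCycle_insertBefore (M.extendRot_of_edge_eq rfl) (M.sameCycle x y h).extendDomain

theorem exists_sameCycle_insertRot_dartMap (hde : d ≠ e) (hd : d.fst = u) (he : e.fst = v)
    (y : G.Dart) : ∃ x : (G.deleteEdges {s(u, v)}).Dart, x.fst = y.fst ∧
      (M.insertRot huv d e).SameCycle y (dartMap (deleteEdgeCopy G u v) x) := by
  rcases dart_deleteEdge_cases huv y with rfl | rfl | ⟨x, rfl⟩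
  · exact ⟨d, hd, 1, M.insertRot_uv huv hde⟩
  · exact ⟨e, he, 1, M.insertRot_vu huv⟩
  · exact ⟨x, rfl, .rfl⟩

/-- The embedding of `G` in which the edge `uv` is drawn inside `M` from the corner before `d` to
the corner before `e`. -/
noncomputable def insertEdge [Finite V] (hde : d ≠ e) (hd : d.fst = u) (he : e.fst = v) :
    RotationSystem G where
  rot := M.insertRot huv d e
  rot_fst := M.insertRot_fst huv hd he
  sameCycle y z hyz := by
    obtain ⟨y', hy', hyy'⟩ := M.exists_sameCycle_insertRot_dartMap huv hde hd he y
    obtain ⟨z', hz', hzz'⟩ := M.exists_sameCycle_insertRot_dartMap huv hde hd he z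
    exact (hyy'.trans (M.sameCycle_insertRot_dartMap huv (hy'.trans (hyz.trans hz'.symm)))).trans
      hzz'.symm

open Classical in
/-- The faces of `M.insertEdge` that the darts belong to if `d` and `e` belong to the same face of
`M`, which is cut by `uv` into two: the part that contains `d` and `vu` keeps its name, and the part
that contains `e` and `uv` is called `none`. -/
noncomputable def splitFace (d e : (G.deleteEdges {s(u, v)}).Dart) : G.Dart → Option M.Face :=
  Function.extend (dartMap (deleteEdgeCopy G u v))
    (fun x => if M.face x = M.face d ∧ x ∉ cycleArc M.facePerm d e then none
      else some (M.face x))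
    fun y => if y = ⟨(u, v), huv⟩ then none else some (M.face d)

open Classical in
theorem splitFace_dartMap (x : (G.deleteEdges {s(u, v)}).Dart) :
    M.splitFace huv d e (dartMap (deleteEdgeCopy G u v) x) =
      if M.face x = M.face d ∧ x ∉ cycleArc M.facePerm d e then none else some (M.face x) :=
  (dartMap_injective _).extend_apply _ _ x

theorem splitFace_uv : M.splitFace huv d e ⟨(u, v), huv⟩ = none := by
  rw [splitFace, Function.extend_apply' _ _ _ fun ⟨x, hx⟩ =>
    dartMap_deleteEdgeCopy_ne_uv huv x hx, if_pos rfl]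

theorem splitFace_vu : M.splitFace huv d e ⟨(v, u), huv.symm⟩ = some (M.face d) := by
  rw [splitFace, Function.extend_apply' _ _ _ fun ⟨x, hx⟩ =>
    dartMap_deleteEdgeCopy_ne_vu huv x hx, if_neg (uv_dart_ne_vu_dart huv).symm]

theorem splitFace_dartMap_left (hde : d ≠ e) :
    M.splitFace huv d e (dartMap (deleteEdgeCopy G u v) d) = some (M.face d) := by
  rw [splitFace_dartMap, if_neg fun h => h.2 (left_mem_cycleArc hde)]

theorem splitFace_dartMap_right (hface : M.face d = M.face e) :
    M.splitFace huv d e (dartMap (deleteEdgeCopy G u v) e) = none := by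
  rw [splitFace_dartMap, if_pos ⟨hface.symm, right_notMem_cycleArc⟩]

theorem splitFace_facePerm_insertEdge [Finite V] (hde : d ≠ e) (hd : d.fst = u) (he : e.fst = v)
    (hface : M.face d = M.face e) (y : G.Dart) :
    M.splitFace huv d e ((M.insertEdge huv hde hd he).facePerm y) = M.splitFace huv d e y := by
  have := finite_dart (G := G.deleteEdges {s(u, v)})
  have hcycle := M.face_eq_iff.mp hface
  change M.splitFace huv d e (M.insertRot huv d e y.symm) = _
  rcases dart_deleteEdge_cases huv y with rfl | rfl | ⟨x, rfl⟩
  · exact (congrArg _ (M.insertRot_vu huv)).trans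
      ((M.splitFace_dartMap_right huv hface).trans (M.splitFace_uv huv).symm)
  · exact (congrArg _ (M.insertRot_uv huv hde)).trans
      ((M.splitFace_dartMap_left huv hde).trans (M.splitFace_vu huv).symm)
  change M.splitFace huv d e (M.insertRot huv d e (dartMap _ x.symm)) = _
  by_cases hxd : M.rot x.symm = d
  · have hx : M.face x = M.face d := by rw [← hxd, ← facePerm_apply, face_facePerm]
    rw [M.insertRot_of_rot_eq_left huv hxd, splitFace_uv, splitFace_dartMap,
      if_pos ⟨hx, notMem_cycleArc_of_apply_eq_left hcycle hxd⟩]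
  by_cases hxe : M.rot x.symm = e
  · have hx : M.face x = M.face d := by rw [hface, ← hxe, ← facePerm_apply, face_facePerm]
    rw [M.insertRot_of_rot_eq_right huv hde hxe, splitFace_vu, splitFace_dartMap,
      if_neg fun h => h.2 (mem_cycleArc_of_apply_eq_right hcycle hde hxe), hx]
  · rw [M.insertRot_of_rot_ne huv hxd hxe, ← facePerm_apply, splitFace_dartMap, splitFace_dartMap,
      face_facePerm, apply_mem_cycleArc_iff (σ := M.facePerm) hxd hxe]

theorem card_face_add_one_le_insertEdge [Finite V] (hde : d ≠ e) (hd : d.fst = u) (he : e.fst = v)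
    (hface : M.face d = M.face e) :
    Nat.card M.Face + 1 ≤ Nat.card (M.insertEdge huv hde hd he).Face := by
  have := finite_dart (G := G)
  have := M.finite_face
  have := (M.insertEdge huv hde hd he).finite_face
  let toSplitFace : (M.insertEdge huv hde hd he).Face → Option M.Face :=
    Quotient.lift (M.splitFace huv d e) fun _ _ h =>
      (eq_of_sameCycle (M.splitFace_facePerm_insertEdge huv hde hd he hface) h).symm
  rw [← Finite.card_option]
  refine Nat.card_le_card_of_surjective toSplitFace fun o => ?_
  cases o with
  | none => exact ⟨face _ ⟨(u, v), huv⟩, M.splitFace_uv huv⟩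
  | some F =>
    obtain ⟨x, rfl⟩ := M.face_surjective F
    by_cases hx : M.face x = M.face d
    · exact ⟨face _ (dartMap _ d), hx ▸ M.splitFace_dartMap_left huv hde⟩
    · exact ⟨face _ (dartMap _ x),
        (M.splitFace_dartMap huv x).trans (if_neg fun h => hx h.1)⟩

theorem IsPlane.isPlanar_of_face_eq [Finite V] {M : (G.deleteEdges {s(u, v)}).RotationSystem}
    (hM : M.IsPlane) (hc : (G.deleteEdges {s(u, v)}).Connected) (huv : G.Adj u v)
    (hd : d.fst = u) (he : e.fst = v) (hface : M.face d = M.face e) : G.IsPlanar := by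
  have hde : d ≠ e := fun h => huv.ne (hd.symm.trans (h ▸ he))
  have hedges : G.edgeSet.ncard = (G.deleteEdges {s(u, v)}).edgeSet.ncard + 1 := by
    rw [edgeSet_deleteEdges]
    exact (Set.ncard_sdiff_singleton_add_one ((mem_edgeSet G).mpr huv) (Set.toFinite _)).symm
  have : Nonempty G.Dart := ⟨⟨(u, v), huv⟩⟩
  have : Nonempty (G.deleteEdges {s(u, v)}).Dart := ⟨d⟩
  have hcG : G.Connected := hc.mono (deleteEdges_le _)
  refine ⟨M.insertEdge huv hde hd he, (isPlane_iff_of_connected _ hcG).mpr ?_⟩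
  have := (M.isPlane_iff_of_connected hc).mp hM
  have := (M.insertEdge huv hde hd he).card_add_card_face_le hcG
  have := M.card_face_add_one_le_insertEdge huv hde hd he hface
  omega

end EdgeInsertion

end SimpleGraph.RotationSystem

namespace SimpleGraph.RotationSystem

section Restrict

variable {V W : Type*} [Finite V] {H : SimpleGraph V} {K : SimpleGraph W}

theorem rot_restrict_of_rot_eq (M : RotationSystem H) (f : Copy K H) {d d' : K.Dart}
    (h : M.rot (dartMap f d) = dartMap f d') : (M.restrict f).rot d = d' := by
  have hle := M.returnTime_le f d d' 1 one_pos (by rwa [pow_one])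
  have hpos := M.returnTime_pos f d
  have hspec := M.next_spec f d
  rw [show M.returnTime f d = 1 by omega, pow_one, h] at hspec
  exact (dartMap_injective f hspec).symm

theorem rot_restrict_of_rot_rot_eq (M : RotationSystem H) (f : Copy K H) {d d' : K.Dart}
    (hskip : M.rot (dartMap f d) ∉ Set.range (dartMap f))
    (h : M.rot (M.rot (dartMap f d)) = dartMap f d') : (M.restrict f).rot d = d' := by
  have hle := M.returnTime_le f d d' 2 two_pos (by rwa [pow_two, Equiv.Perm.mul_apply])
  have hpos := M.returnTime_pos f d
  have hspec := M.next_spec f d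
  have hne : M.returnTime f d ≠ 1 := fun hone => by
    rw [hone, pow_one] at hspec
    exact hskip ⟨_, hspec.symm⟩
  rw [show M.returnTime f d = 2 by omega, pow_two, Equiv.Perm.mul_apply, h] at hspec
  exact (dartMap_injective f hspec).symm

theorem rot_ne_self (R : RotationSystem H) (h2 : H.IsVertexConnected 2) (d : H.Dart) :
    R.rot d ≠ d := by
  have := finite_dart (G := H)
  intro h
  obtain ⟨z, hz, hadj⟩ := h2.exists_adj_ne d.fst d.snd
  have : (⟨(d.fst, z), hadj⟩ : H.Dart) ∈ ({d} : Set H.Dart) :=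
    mem_of_sameCycle (by rintro _ rfl; exact h) (R.sameCycle d ⟨(d.fst, z), hadj⟩ rfl) rfl
  exact hz (congrArg (fun c : H.Dart => c.snd) this)

end Restrict

section VertexDeletion

variable {V W : Type*} {H : SimpleGraph V} {K : SimpleGraph W} {f : Copy K H}
  {M : RotationSystem H}

/-- `K` arises from the 2-connected graph `H`, which is embedded in the plane by `M`, by deleting
vertices such that no two of them are incident with the same face. -/
structure DeletesApart (M : RotationSystem H) (f : Copy K H) : Prop where
  isPlane : M.IsPlane
  isVertexConnected : H.IsVertexConnected 2
  mem_range_dartMap : ∀ d : H.Dart, d.fst ∈ Set.range f → d.snd ∈ Set.range f →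
    d ∈ Set.range (dartMap f)
  fst_eq_of_face_eq : ∀ δ ε : H.Dart, δ.fst ∉ Set.range f → ε.fst ∉ Set.range f →
    M.face δ = M.face ε → δ.fst = ε.fst

namespace DeletesApart

theorem mem_range_dartMap_iff (h : M.DeletesApart f) {d : H.Dart} :
    d ∈ Set.range (dartMap f) ↔ d.fst ∈ Set.range f ∧ d.snd ∈ Set.range f :=
  ⟨by rintro ⟨c, rfl⟩; exact ⟨⟨c.fst, rfl⟩, c.snd, rfl⟩, fun hd => h.mem_range_dartMap d hd.1 hd.2⟩

theorem snd_mem_range (h : M.DeletesApart f) {δ : H.Dart} (hδ : δ.fst ∉ Set.range f) :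
    δ.snd ∈ Set.range f := by
  by_contra hsnd
  have hfst := M.facePerm_fst δ
  exact δ.adj.ne ((h.fst_eq_of_face_eq δ _ hδ (hfst ▸ hsnd) (M.face_facePerm δ).symm).trans hfst)

theorem exists_dartMap_of_forall_ne (h : M.DeletesApart f) {Y : M.Face}
    (hY : ∀ δ : H.Dart, δ.fst ∉ Set.range f → M.face δ ≠ Y) : ∃ d, M.face (dartMap f d) = Y := by
  obtain ⟨y, rfl⟩ := M.face_surjective Y
  obtain ⟨d, rfl⟩ := h.mem_range_dartMap y (by_contra fun hfst => hY y hfst rfl)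
    (by_contra fun hsnd => hY (M.facePerm y) (M.facePerm_fst y ▸ hsnd) (M.face_facePerm y))
  exact ⟨d, rfl⟩

variable [Finite V]

/-- Otherwise `facePerm δ` would lead back to `δ.fst`, the only deleted vertex on the face. -/
theorem exists_dartMap_eq_facePerm (h : M.DeletesApart f) {δ : H.Dart}
    (hδ : δ.fst ∉ Set.range f) : ∃ c, dartMap f c = M.facePerm δ := by
  have hfst := M.facePerm_fst δ
  refine h.mem_range_dartMap_iff.mpr ⟨hfst ▸ h.snd_mem_range hδ, ?_⟩
  by_contra hsnd
  rw [← facePerm_fst] at hsnd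
  have hback := h.fst_eq_of_face_eq _ δ hsnd hδ (by rw [face_facePerm, face_facePerm])
  rw [facePerm_fst] at hback
  exact M.rot_ne_self h.isVertexConnected δ.symm (Dart.ext _ _ (Prod.ext hfst hback))

/-- Face tracing in `K` is face tracing in `H`, except that the edges at the deleted vertices are
skipped. -/
theorem dartMap_facePerm_restrict (h : M.DeletesApart f) (d : K.Dart) :
    dartMap f ((M.restrict f).facePerm d) = M.facePerm (dartMap f d) ∨
      ∃ δ : H.Dart, δ.fst ∉ Set.range f ∧ M.face (M.rot δ) = M.face (dartMap f d) ∧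
        dartMap f ((M.restrict f).facePerm d) = M.facePerm δ := by
  by_cases hr : M.facePerm (dartMap f d) ∈ Set.range (dartMap f)
  · obtain ⟨d', hd'⟩ := hr
    left
    rw [facePerm_apply, rot_restrict_of_rot_eq M f (d := d.symm) (d' := d') hd'.symm, hd']
  · right
    have hfst : (M.facePerm (dartMap f d)).fst ∈ Set.range f :=
      (M.facePerm_fst _).symm ▸ ⟨d.snd, rfl⟩
    have hsnd : (M.facePerm (dartMap f d)).snd ∉ Set.range f := fun hs =>
      hr (h.mem_range_dartMap_iff.mpr ⟨hfst, hs⟩)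
    obtain ⟨d', hd'⟩ := h.exists_dartMap_eq_facePerm (δ := (M.facePerm (dartMap f d)).symm) hsnd
    refine ⟨(M.facePerm (dartMap f d)).symm, hsnd, ?_, ?_⟩
    · rw [face_rot, Dart.symm_symm, face_facePerm]
    · rw [← hd', facePerm_apply, rot_restrict_of_rot_rot_eq M f (d := d.symm) (d' := d') hr]
      rw [facePerm_apply, Dart.symm_symm] at hd'
      exact hd'.symm

theorem exists_deleted_of_face_eq (h : M.DeletesApart f) {d d' : K.Dart}
    (hdd' : (M.restrict f).face d = (M.restrict f).face d') {ε : H.Dart}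
    (hε : ε.fst ∉ Set.range f) (hεd : M.face ε = M.face (dartMap f d)) :
    ∃ δ : H.Dart, δ.fst = ε.fst ∧ M.face δ = M.face (dartMap f d') := by
  have := finite_dart (G := H)
  have := Finite.of_injective _ (dartMap_injective f)
  refine mem_of_sameCycle
    (s := {x | ∃ δ : H.Dart, δ.fst = ε.fst ∧ M.face δ = M.face (dartMap f x)})
    ?_ (face_eq_iff _ |>.mp hdd') ⟨ε, rfl, hεd⟩
  rintro x ⟨ζ, hζ, hζx⟩
  rcases h.dartMap_facePerm_restrict x with hx | ⟨δ, hδ, hδx, hx⟩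
  · exact ⟨ζ, hζ, by rw [hx, face_facePerm, hζx]⟩
  · refine ⟨δ, ?_, by rw [hx, face_facePerm]⟩
    have hδζ := h.fst_eq_of_face_eq (M.rot δ) ζ (by rwa [M.rot_fst]) (by rwa [hζ])
      (hδx.trans hζx.symm)
    rw [← hζ, ← hδζ, M.rot_fst]

theorem face_dartMap_eq_of_forall_ne (h : M.DeletesApart f) {d d' : K.Dart}
    (hno : ∀ δ : H.Dart, δ.fst ∉ Set.range f → M.face δ ≠ M.face (dartMap f d))
    (hdd' : (M.restrict f).face d = (M.restrict f).face d') :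
    M.face (dartMap f d') = M.face (dartMap f d) := by
  have := finite_dart (G := H)
  have := Finite.of_injective _ (dartMap_injective f)
  refine mem_of_sameCycle (s := {x | M.face (dartMap f x) = M.face (dartMap f d)})
    (fun x hx => ?_) (face_eq_iff _ |>.mp hdd') rfl
  rcases h.dartMap_facePerm_restrict x with hx' | ⟨δ, hδ, hδx, -⟩
  · exact (congrArg M.face hx').trans ((M.face_facePerm _).trans hx)
  · exact absurd (hδx.trans hx) (hno (M.rot δ) (by rwa [M.rot_fst]))

/-- If a face of `H` is incident with a deleted vertex, face tracing in `K` cannot follow it all the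
way round. -/
theorem exists_exit (h : M.DeletesApart f) {c : K.Dart} {δ : H.Dart}
    (hδ : δ.fst ∉ Set.range f) (hface : M.face (dartMap f c) = M.face δ) :
    ∃ (d : K.Dart) (ε : H.Dart), (M.restrict f).face d = (M.restrict f).face c ∧
      ε.fst ∉ Set.range f ∧ M.face (M.rot ε) = M.face δ ∧ dartMap f d = M.facePerm ε := by
  have := finite_dart (G := H)
  by_contra! hno
  let traced : Set H.Dart := {y | ∃ d, dartMap f d = y ∧
    (M.restrict f).face d = (M.restrict f).face c ∧ M.face (dartMap f d) = M.face δ}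
  have hclosed : ∀ y ∈ traced, M.facePerm y ∈ traced := by
    rintro _ ⟨d, rfl, hdc, hdδ⟩
    rcases h.dartMap_facePerm_restrict d with hd | ⟨ε, hε, hεd, hd⟩
    · exact ⟨_, hd, by rw [face_facePerm, hdc], by rw [hd, face_facePerm, hdδ]⟩
    · exact absurd hd (hno _ ε (by rw [face_facePerm, hdc]) hε (hεd.trans hdδ))
  obtain ⟨d, rfl, -⟩ := mem_of_sameCycle hclosed (M.face_eq_iff.mp hface) ⟨c, rfl, rfl, hface⟩
  exact hδ ⟨d.fst, rfl⟩

theorem face_eq_of_dartMap_eq_facePerm_rot (h : M.DeletesApart f) {δ : H.Dart}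
    (hδ : δ.fst ∉ Set.range f) {c c' : K.Dart} (hc : dartMap f c = M.facePerm δ)
    (hc' : dartMap f c' = M.facePerm (M.rot δ)) :
    (M.restrict f).face c' = (M.restrict f).face c := by
  obtain ⟨d, ε, hdc', hε, hεδ, hd⟩ := h.exists_exit (c := c') (δ := M.rot δ)
    (by rwa [M.rot_fst]) (by rw [hc', face_facePerm])
  have hfst := h.fst_eq_of_face_eq _ _ (by rwa [M.rot_fst]) (by rwa [M.rot_fst]) hεδ
  have hrot := h.isPlane.dart_eq_of_face_eq h.isVertexConnected hfst hεδ
  rw [M.rot.injective hrot, ← hc] at hd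
  rw [← hdc', dartMap_injective f hd]

/-- The faces around a deleted vertex are merged into a single face. -/
theorem face_eq_of_dartMap_eq_facePerm (h : M.DeletesApart f) {δ ε : H.Dart}
    (hδ : δ.fst ∉ Set.range f) (hδε : δ.fst = ε.fst) {c c' : K.Dart}
    (hc : dartMap f c = M.facePerm δ) (hc' : dartMap f c' = M.facePerm ε) :
    (M.restrict f).face c' = (M.restrict f).face c := by
  have := finite_dart (G := H)
  refine (mem_of_sameCycle (s := {ζ | ζ.fst = δ.fst ∧ ∀ x, dartMap f x = M.facePerm ζ →
    (M.restrict f).face x = (M.restrict f).face c}) ?_ (M.sameCycle δ ε hδε)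
    ⟨rfl, fun x hx => ?_⟩).2 c' hc'
  · rintro ζ ⟨hζ, ih⟩
    refine ⟨(M.rot_fst ζ).trans hζ, fun x hx => ?_⟩
    obtain ⟨y, hy⟩ := h.exists_dartMap_eq_facePerm (hζ ▸ hδ)
    exact (h.face_eq_of_dartMap_eq_facePerm_rot (hζ ▸ hδ) hy hx).trans (ih y hy)
  · rw [dartMap_injective f (hx.trans hc.symm)]

theorem fst_eq_of_face_restrict_eq (h : M.DeletesApart f) {δ ε : H.Dart}
    (hδ : δ.fst ∉ Set.range f) (hε : ε.fst ∉ Set.range f) {c c' : K.Dart}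
    (hc : dartMap f c = M.facePerm δ) (hc' : dartMap f c' = M.facePerm ε)
    (hcc' : (M.restrict f).face c = (M.restrict f).face c') : δ.fst = ε.fst := by
  obtain ⟨ζ, hζ, hζc'⟩ := h.exists_deleted_of_face_eq hcc' hδ (by rw [hc, face_facePerm])
  rw [hc', face_facePerm] at hζc'
  exact hζ.symm.trans (h.fst_eq_of_face_eq ζ ε (hζ ▸ hδ) hε hζc')

theorem exists_face_incident (h : M.DeletesApart f) :
    ∃ Φ : ↥(Set.range f)ᶜ → (M.restrict f).Face, Function.Injective Φ ∧
      ∀ (s : ↥(Set.range f)ᶜ) y, H.Adj s (f y) → (M.restrict f).Incident y (Φ s) := by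
  choose y _ hy using fun s : ↥(Set.range f)ᶜ => h.isVertexConnected.exists_adj_ne s s
  choose c hc using fun s : ↥(Set.range f)ᶜ =>
    h.exists_dartMap_eq_facePerm (δ := ⟨(s, y s), hy s⟩) s.2
  refine ⟨fun s => (M.restrict f).face (c s), fun s t hst => ?_, fun s x hsx => ?_⟩
  · exact Subtype.ext (h.fst_eq_of_face_restrict_eq (δ := ⟨(s, y s), hy s⟩)
      (ε := ⟨(t, y t), hy t⟩) s.2 t.2 (hc s) (hc t) hst)
  · obtain ⟨c', hc'⟩ := h.exists_dartMap_eq_facePerm (δ := ⟨(s, f x), hsx⟩) s.2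
    refine ⟨c', f.injective ?_, h.face_eq_of_dartMap_eq_facePerm (δ := ⟨(s, y s), hy s⟩)
      (ε := ⟨(s, f x), hsx⟩) s.2 rfl (hc s) hc'⟩
    exact (congrArg (fun d => d.fst) hc').trans (M.facePerm_fst _)

theorem card_edgeSet_add_card_dart_le (h : M.DeletesApart f) :
    K.edgeSet.ncard + Nat.card {δ : H.Dart // δ.fst ∉ Set.range f} ≤ H.edgeSet.ncard := by
  have := finite_dart (G := H)
  have := Finite.of_injective _ f.injective
  have hne : ∀ (e : Sym2 W) (δ : H.Dart), δ.fst ∉ Set.range f → e.map f ≠ δ.edge := by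
    intro e δ hδ he
    obtain ⟨y, -, hy⟩ := Sym2.mem_map.mp (he.symm ▸ Sym2.mem_mk_left δ.fst δ.snd : δ.fst ∈ e.map f)
    exact hδ ⟨y, hy⟩
  let toEdge : K.edgeSet ⊕ {δ : H.Dart // δ.fst ∉ Set.range f} → H.edgeSet :=
    Sum.elim f.mapEdgeSet fun δ => ⟨δ.1.edge, δ.1.edge_mem⟩
  have hinj : Function.Injective toEdge := by
    refine f.mapEdgeSet.injective.sumElim (fun δ ε hδε => ?_) fun e δ he =>
      hne e δ.1 δ.2 (congrArg Subtype.val he)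
    rcases (dart_edge_eq_iff δ.1 ε.1).mp (congrArg Subtype.val hδε) with hδε | hδε
    · exact Subtype.ext hδε
    · exact absurd (h.snd_mem_range ε.2) fun hsnd => δ.2 (by rw [hδε]; exact hsnd)
  have := Nat.card_le_card_of_injective toEdge hinj
  rwa [Nat.card_sum, Nat.card_coe_set_eq, Nat.card_coe_set_eq] at this

/-- The faces away from the deleted vertices survive, and each deleted vertex leaves a new face. -/
theorem card_compl_add_card_compl_le (h : M.DeletesApart f) :
    (Set.range fun δ : {δ : H.Dart // δ.fst ∉ Set.range f} => M.face δ)ᶜ.ncard +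
      (Set.range f)ᶜ.ncard ≤ Nat.card (M.restrict f).Face := by
  have := M.finite_face
  have := Finite.of_injective _ f.injective
  have := (M.restrict f).finite_face
  set destroyed := Set.range fun δ : {δ : H.Dart // δ.fst ∉ Set.range f} => M.face δ
  have hno (Y : ↥destroyedᶜ) (δ : H.Dart) (hδ : δ.fst ∉ Set.range f) : M.face δ ≠ Y :=
    fun hδY => Y.2 ⟨⟨δ, hδ⟩, hδY⟩
  choose d hd using fun Y => h.exists_dartMap_of_forall_ne (hno Y)
  choose y _ hy using fun s : ↥(Set.range f)ᶜ => h.isVertexConnected.exists_adj_ne s s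
  choose c hc using fun s : ↥(Set.range f)ᶜ =>
    h.exists_dartMap_eq_facePerm (δ := ⟨(s, y s), hy s⟩) s.2
  have hinj : Function.Injective
      (Sum.elim (fun Y => (M.restrict f).face (d Y)) fun s => (M.restrict f).face (c s)) := by
    refine .sumElim (fun Y Y' hYY' => ?_) (fun s t hst => ?_) fun Y s hYs => ?_
    · have hface := h.face_dartMap_eq_of_forall_ne (hd Y ▸ hno Y) hYY'
      exact Subtype.ext ((hd Y).symm.trans (hface.symm.trans (hd Y')))
    · exact Subtype.ext (h.fst_eq_of_face_restrict_eq (δ := ⟨(s, y s), hy s⟩)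
        (ε := ⟨(t, y t), hy t⟩) s.2 t.2 (hc s) (hc t) hst)
    · obtain ⟨δ, hδ, hδY⟩ := h.exists_deleted_of_face_eq hYs.symm (ε := ⟨(s, y s), hy s⟩) s.2
        (by rw [hc, face_facePerm])
      exact hno Y δ (hδ ▸ s.2) (hδY.trans (hd Y))
  have := Nat.card_le_card_of_injective _ hinj
  rwa [Nat.card_sum, Nat.card_coe_set_eq, Nat.card_coe_set_eq] at this

theorem card_face_add_card_compl_le (h : M.DeletesApart f) :
    Nat.card M.Face + (Set.range f)ᶜ.ncard ≤
      Nat.card (M.restrict f).Face + Nat.card {δ : H.Dart // δ.fst ∉ Set.range f} := by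
  have := finite_dart (G := H)
  have := M.finite_face
  let faceAt (δ : {δ : H.Dart // δ.fst ∉ Set.range f}) := M.face δ
  have hdestroyed := Finite.card_range_le faceAt
  rw [Nat.card_coe_set_eq] at hdestroyed
  have hcompl := Set.ncard_add_ncard_compl (Set.range faceAt)
  have hle : (Set.range faceAt)ᶜ.ncard + _ ≤ _ := h.card_compl_add_card_compl_le
  omega

theorem isPlane_restrict [Nonempty K.Dart] (h : M.DeletesApart f) (hK : K.Connected) :
    (M.restrict f).IsPlane := by
  have := h.isVertexConnected.nonempty_dart
  have := Finite.of_injective _ f.injective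
  have hM := (isPlane_iff_of_connected M (h.isVertexConnected.connected two_pos)).mp h.isPlane
  have hle := (M.restrict f).card_add_card_face_le hK
  have hF := h.card_face_add_card_compl_le
  have hE := h.card_edgeSet_add_card_dart_le
  have hV := Set.ncard_add_ncard_compl (Set.range f)
  rw [← Nat.card_coe_set_eq,
    Nat.card_range_of_injective (show Function.Injective ⇑f from f.injective)] at hV
  rw [isPlane_iff_of_connected _ hK]
  omega

end DeletesApart

end VertexDeletion

end SimpleGraph.RotationSystem

namespace SimpleGraph.IsVertexConnected

variable {V : Type*} [Finite V] {G : SimpleGraph V}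

theorem two_le_ncard_neighborSet (h : G.IsVertexConnected 2) (x : V) :
    2 ≤ (G.neighborSet x).ncard := by
  obtain ⟨y, -, hxy⟩ := h.exists_adj_ne x x
  obtain ⟨z, hzy, hxz⟩ := h.exists_adj_ne x y
  exact (Set.one_lt_ncard_iff).mpr ⟨z, y, hxz, hxy, hzy⟩

theorem card_le_ncard_edgeSet (h : G.IsVertexConnected 2) : Nat.card V ≤ G.edgeSet.ncard := by
  classical
  have := Fintype.ofFinite V
  have hdeg : ∑ _x : V, 2 ≤ ∑ x, G.degree x := Finset.sum_le_sum fun x _ => by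
    rw [← card_neighborSet_eq_degree, ← Nat.card_eq_fintype_card, Nat.card_coe_set_eq]
    exact h.two_le_ncard_neighborSet x
  rw [G.sum_degrees_eq_twice_card_edges, Finset.sum_const, Finset.card_univ, smul_eq_mul,
    ← Nat.card_eq_fintype_card] at hdeg
  rw [← coe_edgeFinset, Set.ncard_coe_finset]
  omega

end SimpleGraph.IsVertexConnected

section DegreeTwo

open SimpleGraph

variable {V : Type*} {G : SimpleGraph V}

theorem eq_of_ncard_neighborSet_eq_two {x a b c : V} (hx : (G.neighborSet x).ncard = 2)
    (ha : G.Adj x a) (hb : G.Adj x b) (hc : G.Adj x c) (hab : a ≠ b) (hca : c ≠ a) : c = b := by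
  obtain ⟨s, t, -, hst⟩ := Set.ncard_eq_two.mp hx
  simp only [← mem_neighborSet, hst, Set.mem_insert_iff, Set.mem_singleton_iff] at ha hb hc
  grind

end DegreeTwo

section EdgeBoundary

open SimpleGraph

variable {V : Type*} {G : SimpleGraph V} {A : Set (Sym2 V)}

/-- The vertices at which the edges in `A` meet the other edges: the common vertices of the
separation that `A` determines. -/
def edgeBoundary (G : SimpleGraph V) (A : Set (Sym2 V)) : Set V :=
  {x | (∃ y, G.Adj x y ∧ s(x, y) ∈ A) ∧ ∃ y, G.Adj x y ∧ s(x, y) ∉ A}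

/-- The subgraph formed by the edges in `A` and their ends, that is, one side of the separation that
`A` determines. -/
def edgeSubgraph (G : SimpleGraph V) (A : Set (Sym2 V)) : G.Subgraph where
  verts := {x | ∃ y, G.Adj x y ∧ s(x, y) ∈ A}
  Adj x y := G.Adj x y ∧ s(x, y) ∈ A
  adj_sub h := h.1
  edge_vert {x y} h := ⟨y, h⟩
  symm := ⟨fun x y h => ⟨h.1.symm, by rw [Sym2.eq_swap]; exact h.2⟩⟩

theorem edgeSet_edgeSubgraph : (edgeSubgraph G A).edgeSet = G.edgeSet ∩ A := by
  ext e
  induction e with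
  | _ x y => rfl

theorem isSeparation_edgeSubgraph (hG : ∀ x, ∃ y, G.Adj x y) :
    IsSeparation (edgeSubgraph G A) (edgeSubgraph G Aᶜ) (edgeBoundary G A).ncard := by
  refine ⟨Subgraph.ext (Set.eq_univ_of_forall fun x => ?_) ?_, ?_, rfl⟩
  · obtain ⟨y, hxy⟩ := hG x
    by_cases hA : s(x, y) ∈ A
    · exact Or.inl ⟨y, hxy, hA⟩
    · exact Or.inr ⟨y, hxy, hA⟩
  · ext x y
    change (G.Adj x y ∧ s(x, y) ∈ A) ∨ (G.Adj x y ∧ s(x, y) ∉ A) ↔ G.Adj x y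
    tauto
  · rw [edgeSet_edgeSubgraph, edgeSet_edgeSubgraph]
    exact disjoint_compl_right.mono Set.inter_subset_right Set.inter_subset_right

theorem edgeBoundary_compl : edgeBoundary G Aᶜ = edgeBoundary G A := by
  ext x
  simp only [edgeBoundary, Set.mem_ofPred_eq, Set.mem_compl_iff, not_not]
  exact and_comm

end EdgeBoundary

namespace SimpleGraph

variable {V : Type*} {G : SimpleGraph V} {A : Set (Sym2 V)}

theorem IsVertexConnected.nontrivial_edgeBoundary (h2 : G.IsVertexConnected 2)
    (hA : (G.edgeSet ∩ A).Nonempty) (hA' : (G.edgeSet ∩ Aᶜ).Nonempty) :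
    (edgeBoundary G A).Nontrivial := by
  by_contra hsub
  obtain ⟨x, hx⟩ : ∃ x, ∀ y ∈ edgeBoundary G A, y = x := by
    rcases (Set.not_nontrivial_iff.mp hsub).eq_empty_or_singleton with h | ⟨x, h⟩
    · obtain ⟨x⟩ := (h2.connected two_pos).nonempty
      exact ⟨x, by simp only [h, Set.mem_empty_iff_false, false_imp_iff, implies_true]⟩
    · exact ⟨x, by simp only [h, Set.mem_singleton_iff, imp_self, implies_true]⟩
  have hend : ∀ e ∈ G.edgeSet, ∃ y z, y ≠ x ∧ G.Adj y z ∧ s(y, z) = e := by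
    rintro ⟨y, z⟩ (hyz : G.Adj y z)
    by_cases hy : y = x
    · exact ⟨z, y, hy ▸ hyz.ne', hyz.symm, Sym2.eq_swap⟩
    · exact ⟨y, z, hy, hyz, rfl⟩
  obtain ⟨_, hE, he⟩ := hA
  obtain ⟨y, z, hyx, hyz, rfl⟩ := hend _ hE
  obtain ⟨_, hE', he'⟩ := hA'
  obtain ⟨y', z', hyx', hyz', rfl⟩ := hend _ hE'
  refine hyx' (hx y' ⟨?_, z', hyz', he'⟩)
  refine h2.forall_of_adj_of_ne (P := fun a => ∃ b, G.Adj a b ∧ s(a, b) ∈ A) hyx ⟨z, hyz, he⟩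
    (fun a b hax _ hab ha => ⟨a, hab.symm, ?_⟩) hyx'
  rw [Sym2.eq_swap]
  by_contra hnot
  exact hax (hx a ⟨ha, b, hab, hnot⟩)

namespace IsInternallyThreeConnected

variable [Finite V] {p q : V}

/-- If the boundary has fewer than two vertices, then one of the sides has no edges at all. -/
theorem ncard_le_two (hG : G.IsInternallyThreeConnected) {x y : V}
    (hA : edgeBoundary G A ⊆ {x, y}) :
    (G.edgeSet ∩ A).ncard ≤ 2 ∨ (G.edgeSet ∩ Aᶜ).ncard ≤ 2 := by
  by_contra! hlt
  have hpos : ∀ {B : Set (Sym2 V)}, 2 < B.ncard → B.Nonempty := fun h =>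
    Set.nonempty_of_ncard_ne_zero (by omega)
  have hlower :=
    Set.one_lt_ncard_iff_nontrivial.mpr (hG.1.nontrivial_edgeBoundary (hpos hlt.1) (hpos hlt.2))
  have hupper := (Set.ncard_le_ncard hA).trans (Set.ncard_insert_le x {y})
  rw [Set.ncard_singleton] at hupper
  have hsep := isSeparation_edgeSubgraph (G := G) (A := A) fun x =>
    (hG.1.exists_adj_ne x x).imp fun _ => And.right
  rw [show (edgeBoundary G A).ncard = 2 by omega] at hsep
  have := hG.2 _ _ hsep
  rw [edgeSet_edgeSubgraph, edgeSet_edgeSubgraph] at this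
  omega

/-- The edges at two adjacent vertices of degree two form a path of length three, which meets the
other edges in its ends only. -/
theorem not_adj_of_degree_two (hG : G.IsInternallyThreeConnected) (hV : 6 ≤ Nat.card V)
    (hp : (G.neighborSet p).ncard = 2) (hq : (G.neighborSet q).ncard = 2) : ¬ G.Adj p q := by
  intro hpq
  obtain ⟨x, hxq, hpx⟩ := hG.1.exists_adj_ne p q
  obtain ⟨y, hyp, hqy⟩ := hG.1.exists_adj_ne q p
  have hadj_p : ∀ z, G.Adj p z → z = q ∨ z = x := fun z hz =>
    or_iff_not_imp_left.mpr (eq_of_ncard_neighborSet_eq_two hp hpq hpx hz hxq.symm)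
  have hadj_q : ∀ z, G.Adj q z → z = p ∨ z = y := fun z hz =>
    or_iff_not_imp_left.mpr (eq_of_ncard_neighborSet_eq_two hq hpq.symm hqy hz hyp.symm)
  let A : Set (Sym2 V) := ({p, q}ᶜ : Set V).sym2
  have hA : edgeBoundary G A ⊆ {x, y} := by
    rintro w ⟨⟨a, -, ha⟩, b, hwb, hb⟩
    have hw : w ∉ ({p, q} : Set V) := ha.1
    rcases not_not.mp fun hbA => hb ⟨hw, hbA⟩ with rfl | rfl
    · exact Or.inl ((hadj_p w hwb.symm).resolve_left fun h => hw (Or.inr h))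
    · exact Or.inr ((hadj_q w hwb.symm).resolve_left fun h => hw (Or.inl h))
  have hpath : G.edgeSet ∩ Aᶜ = {s(p, q), s(p, x), s(q, y)} := by
    ext ⟨a, b⟩
    change G.Adj a b ∧ ¬ (¬ (a = p ∨ a = q) ∧ ¬ (b = p ∨ b = q)) ↔
      s(a, b) = s(p, q) ∨ s(a, b) = s(p, x) ∨ s(a, b) = s(q, y)
    simp only [Sym2.eq_iff]
    grind [Adj.symm]
  have hpath3 : (G.edgeSet ∩ Aᶜ).ncard = 3 := by
    rw [hpath, Set.ncard_eq_three]
    have hne := hpq.ne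
    refine ⟨_, _, _, ?_, ?_, ?_, rfl⟩
    · simp only [ne_eq, Sym2.congr_right, hxq.symm, not_false_iff]
    · simp only [ne_eq, Sym2.eq_iff, hne, hyp.symm, false_and, or_self, not_false_iff]
    · simp only [ne_eq, Sym2.eq_iff, hne, hyp.symm, false_and, or_self, not_false_iff]
  have hsum := Set.ncard_inter_add_ncard_sdiff_eq_ncard G.edgeSet A (Set.toFinite _)
  have hE := hG.1.card_le_ncard_edgeSet
  rw [Set.sdiff_eq] at hsum
  rcases hG.ncard_le_two hA with h | h <;> omega

/-- A neighbour `s` of `p` along an edge in `A` has degree at least three, and all of its edges are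
in `A`. -/
theorem two_lt_ncard (hG : G.IsInternallyThreeConnected) (hV : 6 ≤ Nat.card V)
    (hp : (G.neighborSet p).ncard = 2) (hq : (G.neighborSet q).ncard = 2)
    (hA : edgeBoundary G A ⊆ {p, q}) (hpA : p ∈ edgeBoundary G A) :
    2 < (G.edgeSet ∩ A).ncard := by
  obtain ⟨⟨s, hps, hs⟩, -⟩ := hpA
  have hs_notMem : s ∉ edgeBoundary G A := fun h => (hA h).elim hps.ne' fun hsq =>
    hG.not_adj_of_degree_two hV hp hq (Set.mem_singleton_iff.mp hsq ▸ hps)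
  have hdeg : (G.neighborSet s).ncard ≠ 2 := fun h => hG.not_adj_of_degree_two hV hp h hps
  have hinc : G.incidenceSet s ⊆ G.edgeSet ∩ A := by
    rintro e ⟨hE, hse⟩
    obtain ⟨y, rfl⟩ := hse
    by_contra hy
    exact hs_notMem ⟨⟨p, hps.symm, Sym2.eq_swap ▸ hs⟩, y, hE, fun h => hy ⟨hE, h⟩⟩
  calc 2 < (G.neighborSet s).ncard := (hG.1.two_le_ncard_neighborSet s).lt_of_ne' hdeg
    _ = (G.incidenceSet s).ncard := by
      classical exact (Nat.card_congr (G.incidenceSetEquivNeighborSet s)).symm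
    _ ≤ (G.edgeSet ∩ A).ncard := Set.ncard_le_ncard hinc

/-- Vertices of degree two cannot form a 2-cut. -/
theorem inter_eq_empty_or_inter_compl_eq_empty (hG : G.IsInternallyThreeConnected)
    (hV : 6 ≤ Nat.card V) (hp : (G.neighborSet p).ncard = 2) (hq : (G.neighborSet q).ncard = 2)
    (hA : edgeBoundary G A ⊆ {p, q}) :
    G.edgeSet ∩ A = ∅ ∨ G.edgeSet ∩ Aᶜ = ∅ := by
  by_contra! hne
  obtain ⟨a, ha, b, hb, hab⟩ := hG.1.nontrivial_edgeBoundary hne.1 hne.2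
  have hpA : p ∈ edgeBoundary G A := by
    rcases hA ha with rfl | hqa
    · exact ha
    · rcases hA hb with rfl | hqb
      · exact hb
      · exact absurd (hqa.trans hqb.symm) hab
  have hlt := hG.two_lt_ncard hV hp hq hA hpA
  have hlt' := hG.two_lt_ncard (A := Aᶜ) hV hp hq (edgeBoundary_compl.subset.trans hA)
    (edgeBoundary_compl.superset hpA)
  rcases hG.ncard_le_two hA with h | h <;> omega

end IsInternallyThreeConnected

end SimpleGraph

namespace SimpleGraph.RotationSystem

variable {V : Type*} [Finite V] {G : SimpleGraph V} {R : RotationSystem G}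

/-- Crossing the edge of `c` and crossing back through the edge of `e` is a closed curve. -/
theorem IsPlane.exists_edge_cut (hR : R.IsPlane) (hG : G.Connected) {c e : G.Dart} (hce : c ≠ e)
    (hce' : c ≠ e.symm) (hface : R.face c = R.face e.symm) (hface' : R.face c.symm = R.face e) :
    ∃ S : Set V, c.fst ∈ S ∧ c.snd ∉ S ∧
      ∀ d : G.Dart, d.fst ∈ S → d.snd ∉ S → d = c ∨ d = e := by
  classical
  have := finite_dart (G := G)
  have := Fintype.ofFinite G.Dart
  have : Nonempty G.Dart := ⟨c⟩
  let z (y : G.Dart) : ℝ := ((if y = c then 1 else 0) - (if y = c.symm then 1 else 0)) +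
    ((if y = e then 1 else 0) - (if y = e.symm then 1 else 0))
  have hz : z ∈ antisymm G := fun y => by
    have hsymm : ∀ d : G.Dart, y.symm = d ↔ y = d.symm := fun d => Dart.symm_involutive.eq_iff
    simp only [z, hsymm, Dart.symm_symm]
    ring
  obtain ⟨h, hh⟩ := hR.exists_potential hG hz fun F => by
    simp only [z]
    rw [Finset.sum_add_distrib, sum_face_single_sub, sum_face_single_sub, hface, hface']
    ring
  have hzc : z c = 1 := by simp only [z, hce, hce', c.symm_ne.symm, if_true, if_false]; ring
  refine ⟨{x | h x ≤ h c.fst}, le_refl (h c.fst), fun hc => ?_, fun d hfst hsnd => ?_⟩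
  · have hc : h c.snd ≤ h c.fst := hc
    linarith [hh c]
  · by_contra! hd
    have hzd : z d ≤ 0 := by
      simp only [z, hd.1, hd.2, if_false]
      split_ifs <;> norm_num
    exact hsnd (show h d.snd ≤ h c.fst by linarith [hh d, show h d.fst ≤ h c.fst from hfst])

theorem rot_eq_of_degree_two (h2 : G.IsVertexConnected 2) {d d' : G.Dart}
    (hfst : d.fst = d'.fst) (hne : d ≠ d') (hdeg : (G.neighborSet d.fst).ncard = 2) :
    R.rot d = d' := by
  have hsnd : ∀ c c' : G.Dart, c.fst = c'.fst → c ≠ c' → c.snd ≠ c'.snd := fun c c' h hne h' =>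
    hne (Dart.ext _ _ (Prod.ext h h'))
  have hrot := R.rot_fst d
  exact Dart.ext _ _ (Prod.ext (hrot.trans hfst) (eq_of_ncard_neighborSet_eq_two hdeg d.adj
    (hfst ▸ d'.adj) (hrot ▸ (R.rot d).adj) (hsnd d d' hfst hne)
    (hsnd _ _ hrot (R.rot_ne_self h2 d))))

theorem face_symm_eq_of_degree_two (h2 : G.IsVertexConnected 2) {c c' : G.Dart}
    (hfst : c.fst = c'.fst) (hdeg : (G.neighborSet c.fst).ncard = 2)
    (hface : R.face c ≠ R.face c') : R.face c.symm = R.face c' := by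
  rw [← face_rot, rot_eq_of_degree_two h2 hfst (fun h => hface (h ▸ rfl)) hdeg]

/-- Otherwise a closed curve through the two faces would cross one edge at `p` and one edge at `q`,
so that `p` and `q` would form a 2-cut. -/
theorem IsPlane.face_eq_of_incident (hR : R.IsPlane) (hG : G.IsInternallyThreeConnected)
    (hV : 6 ≤ Nat.card V) {p q : V} (hpq : p ≠ q) (hp : (G.neighborSet p).ncard = 2)
    (hq : (G.neighborSet q).ncard = 2) {X Y : R.Face} (hpX : R.Incident p X)
    (hpY : R.Incident p Y) (hqX : R.Incident q X) (hqY : R.Incident q Y) : X = Y := by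
  by_contra hXY
  obtain ⟨c, rfl, rfl⟩ := hpX
  obtain ⟨c', hc', rfl⟩ := hpY
  obtain ⟨e, rfl, he⟩ := hqY
  obtain ⟨e', he', hface⟩ := hqX
  have hnadj := hG.not_adj_of_degree_two hV hp hq
  obtain ⟨S, hfst, hsnd, hS⟩ := hR.exists_edge_cut (hG.1.connected two_pos) (c := c) (e := e)
    (fun h => hpq (h ▸ rfl)) (fun h => hnadj (by rw [h]; exact e.adj.symm))
    (by rw [face_symm_eq_of_degree_two hG.1 he'.symm hq (by rwa [hface, he, ne_comm]), hface])
    (by rw [face_symm_eq_of_degree_two hG.1 hc'.symm hp hXY, he])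
  have hbd : edgeBoundary G S.sym2 ⊆ {c.fst, e.fst} := by
    rintro w ⟨⟨a, -, ha⟩, b, hwb, hb⟩
    rcases hS ⟨(w, b), hwb⟩ ha.1 fun hbS => hb ⟨ha.1, hbS⟩ with h | h
    · exact Or.inl (congrArg (fun d : G.Dart => d.fst) h)
    · exact Or.inr (congrArg (fun d : G.Dart => d.fst) h)
  obtain ⟨w, hw, hcw⟩ := hG.1.exists_adj_ne c.fst c.snd
  have hwS : w ∈ S := by
    by_contra hwS
    rcases hS ⟨(c.fst, w), hcw⟩ hfst hwS with h | h
    · exact hw (congrArg (fun d : G.Dart => d.snd) h)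
    · exact hpq (congrArg (fun d : G.Dart => d.fst) h :)
  rcases hG.inter_eq_empty_or_inter_compl_eq_empty hV hp hq hbd with h | h
  · exact Set.notMem_empty s(c.fst, w) (h ▸ ⟨hcw, hfst, hwS⟩)
  · exact Set.notMem_empty c.edge (h ▸ ⟨c.adj, fun hc => hsnd hc.2⟩)

theorem IsPlane.forall_incident_iff_eq {ι : Type*} [Nontrivial ι] (hR : R.IsPlane)
    (hG : G.IsInternallyThreeConnected) (hV : 6 ≤ Nat.card V) {x : ι → V}
    (hx : Function.Injective x) (hdeg : ∀ i, (G.neighborSet (x i)).ncard = 2) {A : R.Face}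
    (hA : ∀ i, R.Incident (x i) A) (F : R.Face) : (∀ i, R.Incident (x i) F) ↔ F = A := by
  refine ⟨fun hF => ?_, fun hF => hF ▸ hA⟩
  obtain ⟨i, j, hij⟩ := exists_pair_ne ι
  exact hR.face_eq_of_incident hG hV (hx.ne hij) (hdeg i) (hdeg j) (hF i) (hA i) (hF j) (hA j)

end SimpleGraph.RotationSystem

section Numbering

open SimpleGraph

variable {V : Type*} {G : SimpleGraph V} {s t : V} {A : Set V}

/-- An `st`-numbering of the part `A` of `G`: the labels in `A` are distinct, and every vertex of
`A` other than `s` and `t` has both a lower and a higher neighbour in `A`. Real labels leave room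
for further vertices between any two. -/
structure IsPartialNumbering (G : SimpleGraph V) (s t : V) (A : Set V) (h : V → ℝ) : Prop where
  source_mem : s ∈ A
  target_mem : t ∈ A
  lt : h s < h t
  injOn : Set.InjOn h A
  exists_lower : ∀ x ∈ A, x ≠ s → x ≠ t → ∃ y ∈ A, G.Adj x y ∧ h y < h x
  exists_upper : ∀ x ∈ A, x ≠ s → x ≠ t → ∃ y ∈ A, G.Adj x y ∧ h x < h y

theorem exists_adj_reachable_induce_compl {B : Set V} (hB : (G.induce B).Preconnected) {x w : V}
    (hxB : x ∈ B) (hx : x ∈ Aᶜ) (hwB : w ∈ B) (hw : w ∈ A) :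
    ∃ p ∈ A, p ∈ B ∧ ∃ c : ↥Aᶜ, (G.induce Aᶜ).Reachable ⟨x, hx⟩ c ∧ G.Adj p c := by
  by_contra! hno
  have : Nonempty B := ⟨⟨x, hxB⟩⟩
  obtain ⟨hwA, -⟩ : ∃ hw : w ∈ Aᶜ, (G.induce Aᶜ).Reachable ⟨x, hx⟩ ⟨w, hw⟩ := by
    refine forall_of_adj ⟨hB⟩ (x := ⟨x, hxB⟩) (y := ⟨w, hwB⟩)
      (P := fun y => ∃ hy : y.1 ∈ Aᶜ, (G.induce Aᶜ).Reachable ⟨x, hx⟩ ⟨y, hy⟩) ⟨hx, .refl _⟩ ?_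
    rintro y z hyz ⟨hy, hr⟩
    have hz : z.1 ∈ Aᶜ := fun hz => hno z hz z.2 ⟨y, hy⟩ hr hyz.symm
    have hadj : (G.induce Aᶜ).Adj ⟨y, hy⟩ ⟨z, hz⟩ := hyz
    exact ⟨hz, hr.trans hadj.reachable⟩
  exact hwA hw

theorem exists_ne_adj_reachable_induce_compl (hcut : ∀ x, (G.induce {x}ᶜ).Preconnected)
    (hs : s ∈ A) (ht : t ∈ A) (hst : s ≠ t) {x : V} (hx : x ∉ A) :
    ∃ p ∈ A, ∃ q ∈ A, p ≠ q ∧ ∃ c e : ↥Aᶜ,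
      (G.induce Aᶜ).Reachable c e ∧ G.Adj p c ∧ G.Adj q e := by
  have hxA : ∀ p ∈ A, x ≠ p := fun p hp h => hx (h ▸ hp)
  obtain ⟨p, hp, hps, c, hc, hpc⟩ :=
    exists_adj_reachable_induce_compl (hcut s) (hxA s hs) hx hst.symm ht
  obtain ⟨q, hq, hqp, e, he, hqe⟩ :=
    exists_adj_reachable_induce_compl (hcut p) (hxA p hp) hx (Ne.symm hps) hs
  exact ⟨p, hp, q, hq, Ne.symm hqp, c, e, hc.symm.trans he, hpc, hqe⟩

theorem exists_strictMono_between {T : Set ℝ} (hT : T.Finite) {a b : ℝ} (hb : b ∈ T) (hab : a < b) :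
    ∃ f : ℕ → ℝ, StrictMono f ∧ (∀ i, a < f i) ∧ ∀ i, ∀ c ∈ T, a < c → f i < c := by
  obtain ⟨m, ⟨-, ham⟩, hmin⟩ :=
    Set.exists_min_image {c ∈ T | a < c} id (hT.subset (Set.sep_subset _ _)) ⟨b, hb, hab⟩
  obtain ⟨f, hf, hmem, -⟩ := exists_seq_strictMono_tendsto' ham
  exact ⟨f, hf, fun i => (hmem i).1, fun i c hc hac => (hmem i).2.trans_le (hmin c ⟨hc, hac⟩)⟩

theorem exists_eqOn_extension {α β : Type*} {S : Set α} (h : α → β) (f : ℕ → β) {n : ℕ}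
    {g : ℕ → α} (hginj : Set.InjOn g {i | i ≤ n}) (hgS : ∀ i, g i ∉ S) :
    ∃ h' : α → β, Set.EqOn h' h S ∧ ∀ i ≤ n, h' (g i) = f i := by
  classical
  refine ⟨fun y => if y ∈ S then h y else f (Function.invFunOn g {i | i ≤ n} y),
    fun x hx => if_pos hx, fun i hi => ?_⟩
  beta_reduce
  rw [if_neg (hgS i), hginj.leftInvOn_invFunOn hi]

namespace IsPartialNumbering

variable {h : V → ℝ}

theorem neg (hA : IsPartialNumbering G s t A h) : IsPartialNumbering G t s A (-h) where
  source_mem := hA.target_mem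
  target_mem := hA.source_mem
  lt := neg_lt_neg hA.lt
  injOn := fun _ hx _ hy hxy => hA.injOn hx hy (neg_injective hxy)
  exists_lower := fun x hx hxt hxs =>
    (hA.exists_upper x hx hxs hxt).imp fun _ => .imp_right <| .imp_right neg_lt_neg
  exists_upper := fun x hx hxt hxs =>
    (hA.exists_lower x hx hxs hxt).imp fun _ => .imp_right <| .imp_right neg_lt_neg

theorem pair (hst : s ≠ t) [DecidableEq V] :
    IsPartialNumbering G s t {s, t} (fun x => if x = s then 0 else 1) where
  source_mem := Or.inl rfl
  target_mem := Or.inr rfl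
  lt := by simp only [hst.symm, if_true, if_false, zero_lt_one]
  injOn := by rintro x (rfl | rfl) y (rfl | rfl) hxy <;> simp_all
  exists_lower := by rintro x (rfl | rfl) hxs hxt <;> contradiction
  exists_upper := by rintro x (rfl | rfl) hxs hxt <;> contradiction

variable [Finite V]

theorem source_le (hA : IsPartialNumbering G s t A h) {x : V} (hx : x ∈ A) : h s ≤ h x := by
  obtain ⟨m, hm, hmin⟩ := Set.exists_min_image A h (Set.toFinite A) ⟨x, hx⟩
  suffices m = s from this ▸ hmin x hx
  by_contra hne
  have hmt : m ≠ t := by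
    rintro rfl
    exact (hmin s hA.source_mem).not_gt hA.lt
  obtain ⟨y, hy, -, hlt⟩ := hA.exists_lower m hm hne hmt
  exact (hmin y hy).not_gt hlt

theorem insert_ear (hA : IsPartialNumbering G s t A h) {p q : V} (hp : p ∈ A) (hq : q ∈ A)
    (hpq : h p < h q) {n : ℕ} {g : ℕ → V} (hginj : Set.InjOn g {i | i ≤ n}) (hgA : ∀ i, g i ∉ A)
    (hgadj : ∀ i < n, G.Adj (g i) (g (i + 1))) (hpg : G.Adj p (g 0)) (hqg : G.Adj q (g n)) :
    ∃ h', IsPartialNumbering G s t (A ∪ g '' {i | i ≤ n}) h' := by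
  obtain ⟨f, hf, hpf, hfA⟩ := exists_strictMono_between (Set.toFinite (h '' A)) ⟨q, hq, rfl⟩ hpq
  obtain ⟨h', hh', hh'g⟩ := exists_eqOn_extension h f hginj hgA
  have hne : ∀ x ∈ A, ∀ i ≤ n, h' x ≠ h' (g i) := by
    intro x hx i hi heq
    rw [hh' hx, hh'g i hi] at heq
    exact (hfA i (h x) ⟨x, hx, rfl⟩ (heq.symm ▸ hpf i)).ne' heq
  refine ⟨h', Or.inl hA.source_mem, Or.inl hA.target_mem, ?_, ?_, ?_, ?_⟩
  · rw [hh' hA.source_mem, hh' hA.target_mem]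
    exact hA.lt
  · rintro x (hx | ⟨i, hi, rfl⟩) y (hy | ⟨j, hj, rfl⟩) hxy
    · exact hA.injOn hx hy (by rwa [hh' hx, hh' hy] at hxy)
    · exact absurd hxy (hne x hx j hj)
    · exact absurd hxy.symm (hne y hy i hi)
    · rw [hh'g i hi, hh'g j hj] at hxy
      rw [hf.injective hxy]
  · rintro x (hx | ⟨_ | i, hi : _ ≤ n, rfl⟩) hxs hxt
    · obtain ⟨y, hy, hadj, hlt⟩ := hA.exists_lower x hx hxs hxt
      exact ⟨y, Or.inl hy, hadj, by rwa [hh' hx, hh' hy]⟩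
    · exact ⟨p, Or.inl hp, hpg.symm, by rw [hh' hp, hh'g 0 hi]; exact hpf 0⟩
    · have hi' : i ≤ n := Nat.le_of_succ_le hi
      refine ⟨g i, Or.inr ⟨i, hi', rfl⟩, (hgadj i hi).symm, ?_⟩
      rw [hh'g i hi', hh'g (i + 1) hi]
      exact hf i.lt_succ_self
  · rintro x (hx | ⟨i, hi : i ≤ n, rfl⟩) hxs hxt
    · obtain ⟨y, hy, hadj, hlt⟩ := hA.exists_upper x hx hxs hxt
      exact ⟨y, Or.inl hy, hadj, by rwa [hh' hx, hh' hy]⟩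
    rcases hi.lt_or_eq with hlt | rfl
    · refine ⟨g (i + 1), Or.inr ⟨i + 1, hlt, rfl⟩, hgadj i hlt, ?_⟩
      rw [hh'g i hi, hh'g (i + 1) hlt]
      exact hf i.lt_succ_self
    · refine ⟨q, Or.inl hq, hqg.symm, ?_⟩
      rw [hh' hq, hh'g i hi]
      exact hfA i (h q) ⟨q, hq, rfl⟩ hpq

theorem exists_ssuperset_of_lt (hA : IsPartialNumbering G s t A h) {p q : V} (hp : p ∈ A)
    (hq : q ∈ A) (hpq : h p < h q) {c e : ↥Aᶜ} (hce : (G.induce Aᶜ).Reachable c e)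
    (hpc : G.Adj p c) (hqe : G.Adj q e) :
    ∃ A' h', A ⊂ A' ∧ IsPartialNumbering G s t A' h' := by
  classical
  obtain ⟨W, hW⟩ := hce.exists_isPath
  obtain ⟨h', hh'⟩ := hA.insert_ear hp hq hpq (n := W.length) (g := fun i => (W.getVert i).1)
    (fun i hi j hj hij => hW.getVert_injOn hi hj (Subtype.ext hij))
    (fun i => (W.getVert i).2) (fun i hi => W.adj_getVert_succ hi)
    (by rwa [W.getVert_zero]) (by rwa [W.getVert_length])
  have hc : c.1 ∈ (fun i => (W.getVert i).1) '' {i | i ≤ W.length} :=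
    ⟨0, W.length.zero_le, congrArg Subtype.val W.getVert_zero⟩
  exact ⟨_, h', ⟨Set.subset_union_left, fun hsub => c.2 (hsub (Or.inr hc))⟩, hh'⟩

theorem exists_ssuperset (hA : IsPartialNumbering G s t A h)
    (hcut : ∀ x, (G.induce {x}ᶜ).Preconnected) {x : V} (hx : x ∉ A) :
    ∃ A' h', A ⊂ A' ∧ IsPartialNumbering G s t A' h' := by
  obtain ⟨p, hp, q, hq, hpq, c, e, hce, hpc, hqe⟩ := exists_ne_adj_reachable_induce_compl hcut
    hA.source_mem hA.target_mem (fun hst => hA.lt.ne (congrArg h hst)) hx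
  rcases lt_or_gt_of_ne (hA.injOn.ne hp hq hpq) with hlt | hlt
  · exact hA.exists_ssuperset_of_lt hp hq hlt hce hpc hqe
  · exact hA.exists_ssuperset_of_lt hq hp hlt hce.symm hqe hpc

theorem exists_univ (hcut : ∀ x, (G.induce {x}ᶜ).Preconnected) (hst : s ≠ t) :
    ∃ h, IsPartialNumbering G s t Set.univ h := by
  classical
  obtain ⟨A, ⟨h, hA⟩, hmax⟩ := (Set.toFinite {A | ∃ h, IsPartialNumbering G s t A h}).exists_maximal
    ⟨_, _, pair hst⟩
  suffices A = Set.univ from ⟨h, this ▸ hA⟩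
  by_contra hne
  obtain ⟨x, hx⟩ := (Set.ne_univ_iff_exists_notMem A).mp hne
  obtain ⟨A', h', hlt, hA'⟩ := hA.exists_ssuperset hcut hx
  exact hlt.2 (hmax ⟨h', hA'⟩ hlt.1)

theorem exists_adj_lt (hG : IsPartialNumbering G s t Set.univ h) (hc : G.Connected) {x : V}
    (hx : x ≠ s) : ∃ y, G.Adj x y ∧ h y < h x := by
  by_cases hxt : x = t
  · subst hxt
    have : Nontrivial V := ⟨x, s, hx⟩
    obtain ⟨y, hy⟩ := hc.preconnected.exists_adj_of_nontrivial x
    have hle : h y ≤ h x := neg_le_neg_iff.mp (hG.neg.source_le (Set.mem_univ y))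
    exact ⟨y, hy, hle.lt_of_ne (hG.injOn.ne (Set.mem_univ y) (Set.mem_univ x) hy.ne')⟩
  · obtain ⟨y, -, hy⟩ := hG.exists_lower x (Set.mem_univ x) hx hxt
    exact ⟨y, hy⟩

end IsPartialNumbering

theorem exists_nat_lt_of_lt {α : Type*} [Finite V] [Preorder α] (h : V → α) :
    ∃ k : V → ℕ, ∀ x y, h x < h y → k x < k y :=
  ⟨fun x => {y | h y < h x}.ncard, fun _ _ hxy => Set.ncard_lt_ncard
    ⟨fun _ hz => lt_trans hz hxy, fun hsub => lt_irrefl _ (hsub hxy)⟩⟩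

theorem exists_st_numbering [Finite V] (hc : G.Connected)
    (hcut : ∀ x, (G.induce {x}ᶜ).Preconnected) (hst : s ≠ t) :
    ∃ k : V → ℕ, Function.Injective k ∧ (∀ x ≠ s, ∃ y, G.Adj x y ∧ k y < k x) ∧
      ∀ x ≠ t, ∃ y, G.Adj x y ∧ k x < k y := by
  obtain ⟨h, hG⟩ := IsPartialNumbering.exists_univ hcut hst
  obtain ⟨k, hk⟩ := exists_nat_lt_of_lt h
  refine ⟨k, fun x y hxy => ?_, fun x hx => ?_, fun x hx => ?_⟩
  · by_contra hne
    rcases lt_or_gt_of_ne (hG.injOn.ne (Set.mem_univ x) (Set.mem_univ y) hne) with hlt | hlt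
    · exact (hk x y hlt).ne hxy
    · exact (hk y x hlt).ne' hxy
  · exact (hG.exists_adj_lt hc hx).imp fun y hy => ⟨hy.1, hk y x hy.2⟩
  · exact (hG.neg.exists_adj_lt hc hx).imp fun y hy => ⟨hy.1, hk x y (neg_lt_neg_iff.mp hy.2)⟩

end Numbering

namespace SimpleGraph.RotationSystem

variable {V : Type*} [Finite V] {G : SimpleGraph V} {R : RotationSystem G}

theorem IsPlane.dualGraph_connected (hR : R.IsPlane) (h2 : G.IsVertexConnected 2) :
    R.dualGraph.Connected := by
  obtain ⟨d₀⟩ := h2.nonempty_dart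
  have hadj : ∀ d, R.dualGraph.Adj (R.face d) (R.face d.symm) := fun d =>
    ⟨(hR.face_symm_ne h2 d).symm, d, rfl, rfl⟩
  have hreach : ∀ d, R.dualGraph.Reachable (R.face d₀) (R.face d) := by
    refine R.forall_dart_of_connected (h2.connected two_pos) (d := d₀) (.refl _)
      (fun d hd => hd.trans (hadj d).reachable) fun d hd => ?_
    rw [face_rot]
    exact hd.trans (hadj d).reachable
  have : Nonempty R.Face := ⟨R.face d₀⟩
  refine ⟨fun F F' => ?_⟩
  obtain ⟨d, rfl⟩ := R.face_surjective F
  obtain ⟨d', rfl⟩ := R.face_surjective F'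
  exact (hreach d).symm.trans (hreach d')

theorem IsPlane.dualGraph_induce_preconnected (hR : R.IsPlane) (h2 : G.IsVertexConnected 2)
    (X : R.Face) : (R.dualGraph.induce {X}ᶜ).Preconnected := by
  rintro ⟨F, hF⟩ ⟨F', hF'⟩
  obtain ⟨_, hr⟩ : F' ∈ {Y | ∃ hY : Y ∈ ({X}ᶜ : Set R.Face),
      (R.dualGraph.induce {X}ᶜ).Reachable ⟨F, hF⟩ ⟨Y, hY⟩} := by
    refine hR.forall_face_of_dualAdj h2 (F₀ := F) hF ?_ ?_ hF'
    · exact ⟨hF, .refl _⟩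
    rintro Y Z hY hZ hYZ ⟨_, hr⟩
    have hadj : (R.dualGraph.induce {X}ᶜ).Adj ⟨Y, hY⟩ ⟨Z, hZ⟩ := hYZ
    exact ⟨hZ, hr.trans hadj.reachable⟩
  exact hr

end SimpleGraph.RotationSystem

section TightCoefficients

open Function

variable {k ι X : Type*} [Field k] [Fintype ι]

theorem sum_mul_update [DecidableEq ι] (f β : ι → k) (i : ι) (c : k) :
    ∑ j, f j * update β i c j = ∑ j, f j * β j + f i * (c - β i) := by
  have hupdate : update β i c = β + Pi.single i (c - β i) := by
    ext j
    rcases eq_or_ne j i with rfl | hj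
    · simp
    · simp [hj]
  simp only [hupdate, Pi.add_apply, mul_add, Finset.sum_add_distrib, Pi.single_apply, mul_ite,
    mul_zero, Finset.sum_ite_eq', Finset.mem_univ, if_true]

variable [LinearOrder k] [IsStrictOrderedRing k]

theorem lt_of_sum_mul_lt_sum_mul_update [DecidableEq ι] {f β : ι → k} {i : ι} {c : k}
    (hf : 0 ≤ f i) (h : ∑ j, f j * β j < ∑ j, f j * update β i c j) : β i < c := by
  rw [sum_mul_update, lt_add_iff_pos_right] at h
  exact sub_pos.mp (pos_of_mul_pos_right h hf)

theorem exists_tight_update [DecidableEq ι] [Finite X] (r : X → k) (D : ι → X → k) (β : ι → k)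
    {i : ι} (hi : ∃ x, 0 < D i x ∧ ∑ j, D j x * β j < r x) :
    ∃ c > β i, (∀ x, 0 < D i x → r x ≤ ∑ j, D j x * update β i c j) ∧
      ∃ x, 0 < D i x ∧ ∑ j, D j x * update β i c j = r x := by
  obtain ⟨x₀, hx₀, hlt⟩ := hi
  obtain ⟨m, hm, hmax⟩ := Set.exists_max_image {x | 0 < D i x}
    (fun x => (r x - ∑ j, D j x * β j) / D i x) (Set.toFinite _) ⟨x₀, hx₀⟩
  have hcover : ∀ x, 0 < D i x →
      r x ≤ ∑ j, D j x * update β i (β i + (r m - ∑ j, D j m * β j) / D i m) j := fun x hx => by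
    have hle := (div_le_iff₀' hx).mp (hmax x hx)
    rw [sum_mul_update, add_sub_cancel_left]
    exact sub_le_iff_le_add'.mp hle
  refine ⟨_, lt_of_sum_mul_lt_sum_mul_update hx₀.le (hlt.trans_le (hcover x₀ hx₀)), hcover, m, hm,
    ?_⟩
  rw [sum_mul_update, add_sub_cancel_left, mul_div_cancel₀ _ (ne_of_gt hm), add_sub_cancel]

/-- Small coefficients `δ` are used except at two indices `i₀` and `i₁`. That at `i₀` makes the
inequality at `U i₁`, in which `i₁` plays no role, an equality, and then the least possible one is
taken at `i₁`. -/
theorem exists_tight_coefficients [Nontrivial ι] [Finite X] {r : X → k} {D : ι → X → k}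
    {U : ι → X} (hU : Injective U) (hD₀ : ∀ i x, 0 ≤ D i x) (hDU : ∀ i, D i (U i) = 0)
    (hD : ∀ i x, D i x = 0 → x = U i ∨ r x ≤ 0) (hr : ∀ i, 0 < r (U i)) :
    ∃ α : ι → k, (∀ i, 0 < α i) ∧ (∀ x, r x ≤ ∑ j, D j x * α j) ∧
      ∀ i, ∃ x, 0 < D i x ∧ ∑ j, D j x * α j = r x := by
  classical
  obtain ⟨i₀, i₁, hne⟩ := exists_pair_ne ι
  have hpos : ∀ {i j}, i ≠ j → 0 < D i (U j) := fun {i j} hij => (hD₀ i _).lt_of_ne' fun h =>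
    (hD i _ h).elim (fun h => hij (hU h).symm) (hr j).not_ge
  have hsum : ∀ {i} (β : ι → k) (c : k),
      ∑ j, D j (U i) * update β i c j = ∑ j, D j (U i) * β j := fun β c => by
    rw [sum_mul_update, hDU, zero_mul, add_zero]
  obtain ⟨δ, hδ, hδr⟩ := exists_pos_mul_lt (lt_min (hr i₀) (hr i₁))
    (max (∑ j, D j (U i₀)) (∑ j, D j (U i₁)))
  have hδ₀ : ∑ j, D j (U i₀) * δ < r (U i₀) := by
    rw [← Finset.sum_mul]
    exact (mul_le_mul_of_nonneg_right (le_max_left _ _) hδ.le).trans_lt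
      (hδr.trans_le (min_le_left _ _))
  have hδ₁ : ∑ j, D j (U i₁) * δ < r (U i₁) := by
    rw [← Finset.sum_mul]
    exact (mul_le_mul_of_nonneg_right (le_max_right _ _) hδ.le).trans_lt
      (hδr.trans_le (min_le_right _ _))
  obtain ⟨α₀, hα₀, -, -, -, htight₁⟩ := exists_tight_update (X := Unit) (fun _ => r (U i₁))
    (fun j _ => D j (U i₁)) (fun _ => δ) ⟨(), hpos hne, hδ₁⟩
  obtain ⟨c, hc, hcover, hm⟩ := exists_tight_update r D (update (fun _ => δ) i₀ α₀)
    ⟨U i₀, hpos hne.symm, (hsum _ _).trans_lt hδ₀⟩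
  set β : ι → k := update (fun _ => δ) i₀ α₀
  have hβ : ∀ i, 0 < β i := (forall_update_iff _ fun _ y => 0 < y).mpr
    ⟨hδ.trans hα₀, fun _ _ => hδ⟩
  have hα : ∀ i, 0 < update β i₁ c i := (forall_update_iff _ fun _ y => 0 < y).mpr
    ⟨(hβ i₁).trans hc, fun i _ => hβ i⟩
  refine ⟨update β i₁ c, hα, fun x => ?_, fun i => ?_⟩
  · rcases (hD₀ i₁ x).eq_or_lt' with hx | hx
    · rcases hD i₁ x hx with rfl | hrx
      · exact ((hsum β c).trans htight₁).ge
      · exact hrx.trans (Finset.sum_nonneg fun j _ => mul_nonneg (hD₀ j x) (hα j).le)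
    · exact hcover x hx
  · rcases eq_or_ne i i₁ with rfl | hi
    · exact hm
    · exact ⟨U i₁, hpos hi, (hsum β c).trans htight₁⟩

end TightCoefficients

theorem exists_common_denominator {ι : Type*} [Finite ι] {α : ι → ℚ} (hα : ∀ i, 0 < α i) :
    ∃ n : ℕ, 0 < n ∧ ∃ η : ι → ℕ, (∀ i, 0 < η i) ∧ ∀ i, (η i : ℚ) = n * α i := by
  obtain ⟨b, hb⟩ := IsLocalization.exist_integer_multiples_of_finite (nonZeroDivisors ℤ) α
  have hb₀ : (b : ℤ) ≠ 0 := nonZeroDivisors.coe_ne_zero b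
  choose z hz using hb
  have hη : ∀ i, ((z i).natAbs : ℚ) = (b : ℤ).natAbs * α i := fun i => by
    have hzi : (z i : ℚ) = (b : ℤ) * α i := by simpa using hz i
    rw [Nat.cast_natAbs, Nat.cast_natAbs, Int.cast_abs, Int.cast_abs, hzi, abs_mul,
      abs_of_pos (hα i)]
  refine ⟨(b : ℤ).natAbs, Int.natAbs_pos.mpr hb₀, fun i => (z i).natAbs, fun i => ?_, hη⟩
  have hpos : (0 : ℚ) < (z i).natAbs := by
    rw [hη]
    exact mul_pos (Nat.cast_pos.mpr (Int.natAbs_pos.mpr hb₀)) (hα i)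
  exact Nat.cast_pos.mp hpos

namespace SimpleGraph.RotationSystem

variable {V : Type*} {G : SimpleGraph V} {R : RotationSystem G}

section Distance

theorem IsDualWalk.append {F F' F'' : R.Face} {l l' : List G.Dart} (h : R.IsDualWalk F l F')
    (h' : R.IsDualWalk F' l' F'') : R.IsDualWalk F (l ++ l') F'' := by
  induction l generalizing F with
  | nil => cases h; exact h'
  | cons d l ih => exact ⟨h.1, ih h.2⟩

theorem dualLength_cons (w : Sym2 V → ℕ) (d : G.Dart) (l : List G.Dart) :
    dualLength w (d :: l) = w d.edge + dualLength w l :=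
  List.sum_cons

theorem dualLength_mul (w : Sym2 V → ℕ) (n : ℕ) (l : List G.Dart) :
    dualLength (fun e => n * w e) l = n * dualLength w l :=
  List.sum_map_mul_left ..

theorem faceDist_le (w : Sym2 V → ℕ) {F F' : R.Face} {l : List G.Dart}
    (hl : R.IsDualWalk F l F') : R.faceDist w F F' ≤ dualLength w l :=
  Nat.sInf_le ⟨l, hl, rfl⟩

theorem exists_dualLength_eq_faceDist (hc : R.dualGraph.Connected) (w : Sym2 V → ℕ)
    (F F' : R.Face) : ∃ l, R.IsDualWalk F l F' ∧ dualLength w l = R.faceDist w F F' := by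
  obtain ⟨l, hl⟩ : ∃ l, R.IsDualWalk F l F' := by
    refine forall_of_adj hc (P := fun F' => ∃ l, R.IsDualWalk F l F') ⟨[], rfl⟩ ?_ F'
    rintro Y Z ⟨-, d, hY, hZ⟩ ⟨l, hl⟩
    exact ⟨l ++ [d], hl.append ⟨hY, hZ⟩⟩
  exact Nat.sInf_mem (s := {n | ∃ l, R.IsDualWalk F l F' ∧ dualLength w l = n}) ⟨_, l, hl, rfl⟩

theorem vertexDist_le (w : Sym2 V → ℕ) {x : V} {F' : R.Face} (hx : R.Incident x F') (F : R.Face) :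
    R.vertexDist w x F ≤ R.faceDist w F' F :=
  Nat.sInf_le ⟨F', hx, rfl⟩

theorem exists_faceDist_eq_vertexDist (w : Sym2 V → ℕ) {x : V} (hx : ∃ F, R.Incident x F)
    (F : R.Face) : ∃ F', R.Incident x F' ∧ R.faceDist w F' F = R.vertexDist w x F := by
  obtain ⟨F₀, hF₀⟩ := hx
  exact Nat.sInf_mem (s := {n | ∃ F', R.Incident x F' ∧ R.faceDist w F' F = n}) ⟨_, F₀, hF₀, rfl⟩

theorem faceDist_eq_zero_iff (hc : R.dualGraph.Connected) {w : Sym2 V → ℕ}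
    (hw : ∀ e ∈ G.edgeSet, 0 < w e) {F F' : R.Face} : R.faceDist w F F' = 0 ↔ F = F' := by
  constructor
  · intro h
    obtain ⟨l, hl, hlen⟩ := exists_dualLength_eq_faceDist hc w F F'
    cases l with
    | nil => exact hl
    | cons d l =>
      rw [h, dualLength_cons, Nat.add_eq_zero_iff] at hlen
      exact absurd hlen.1 (hw _ d.edge_mem).ne'
  · rintro rfl
    exact Nat.le_zero.mp (faceDist_le w (l := []) rfl)

theorem vertexDist_eq_zero_iff (hc : R.dualGraph.Connected) {w : Sym2 V → ℕ}
    (hw : ∀ e ∈ G.edgeSet, 0 < w e) {x : V} (hx : ∃ F, R.Incident x F) {F : R.Face} :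
    R.vertexDist w x F = 0 ↔ R.Incident x F := by
  constructor
  · intro h
    obtain ⟨F', hF', hdist⟩ := exists_faceDist_eq_vertexDist w hx F
    rw [h, faceDist_eq_zero_iff hc hw] at hdist
    exact hdist ▸ hF'
  · intro h
    exact Nat.le_zero.mp ((vertexDist_le w h F).trans_eq ((faceDist_eq_zero_iff hc hw).mpr rfl))

theorem faceDist_mul (hc : R.dualGraph.Connected) (w : Sym2 V → ℕ) (n : ℕ) (F F' : R.Face) :
    R.faceDist (fun e => n * w e) F F' = n * R.faceDist w F F' := by
  apply le_antisymm
  · obtain ⟨l, hl, hlen⟩ := exists_dualLength_eq_faceDist hc w F F'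
    exact hlen ▸ dualLength_mul w n l ▸ faceDist_le _ hl
  · obtain ⟨l, hl, hlen⟩ := exists_dualLength_eq_faceDist hc (fun e => n * w e) F F'
    exact hlen ▸ dualLength_mul w n l ▸ Nat.mul_le_mul_left n (faceDist_le w hl)

theorem vertexDist_mul (hc : R.dualGraph.Connected) (w : Sym2 V → ℕ) (n : ℕ) {x : V}
    (hx : ∃ F, R.Incident x F) (F : R.Face) :
    R.vertexDist (fun e => n * w e) x F = n * R.vertexDist w x F := by
  apply le_antisymm
  · obtain ⟨F', hF', hdist⟩ := exists_faceDist_eq_vertexDist w hx F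
    exact hdist ▸ faceDist_mul hc w n F' F ▸ vertexDist_le _ hF' F
  · obtain ⟨F', hF', hdist⟩ := exists_faceDist_eq_vertexDist (fun e => n * w e) hx F
    exact hdist ▸ faceDist_mul hc w n F' F ▸ Nat.mul_le_mul_left n (vertexDist_le w hF' F)

theorem IsBalanced.mul (hc : R.dualGraph.Connected) {w : Sym2 V → ℕ} {F F' : R.Face}
    (h : R.IsBalanced w F F') (n : ℕ) : R.IsBalanced (fun e => n * w e) F F' := by
  intro e he
  obtain ⟨l, hl, hlen, hd⟩ := h e he
  exact ⟨l, hl, by rw [dualLength_mul, hlen, faceDist_mul hc], hd⟩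

end Distance

section Numbering

/-- A list of darts is increasing for a numbering `h` of the faces if every dart crosses its edge
towards the face with the larger number. The increasing walks from the first to the last face of an
`st`-numbering of the dual are the shortest ones for the weights `|h F - h F'|`. -/
def IsIncreasing (R : RotationSystem G) (h : R.Face → ℕ) (l : List G.Dart) : Prop :=
  ∀ d ∈ l, h (R.face d) < h (R.face d.symm)

variable {h : R.Face → ℕ} {w : Sym2 V → ℕ}

theorem isIncreasing_cons {d : G.Dart} {l : List G.Dart} :
    R.IsIncreasing h (d :: l) ↔ h (R.face d) < h (R.face d.symm) ∧ R.IsIncreasing h l :=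
  List.forall_mem_cons

theorem isIncreasing_append {l l' : List G.Dart} :
    R.IsIncreasing h (l ++ l') ↔ R.IsIncreasing h l ∧ R.IsIncreasing h l' :=
  List.forall_mem_append

theorem IsDualWalk.le_add_dualLength
    (hw : ∀ d : G.Dart, w d.edge = Nat.dist (h (R.face d)) (h (R.face d.symm)))
    {F F' : R.Face} {l : List G.Dart} (hl : R.IsDualWalk F l F') :
    h F' ≤ h F + dualLength w l := by
  induction l generalizing F with
  | nil => cases hl; exact Nat.le_add_right _ _
  | cons d l ih =>
    obtain ⟨rfl, hl⟩ := hl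
    have htail := ih hl
    rw [dualLength_cons, hw, Nat.dist]
    lia

theorem IsDualWalk.dualLength_eq_of_isIncreasing
    (hw : ∀ d : G.Dart, w d.edge = Nat.dist (h (R.face d)) (h (R.face d.symm)))
    {F F' : R.Face} {l : List G.Dart} (hl : R.IsDualWalk F l F') (hinc : R.IsIncreasing h l) :
    h F + dualLength w l = h F' := by
  induction l generalizing F with
  | nil => cases hl; rfl
  | cons d l ih =>
    obtain ⟨rfl, hl⟩ := hl
    obtain ⟨hd, hinc⟩ := isIncreasing_cons.mp hinc
    have htail := ih hl hinc
    rw [dualLength_cons, hw, Nat.dist]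
    lia

theorem IsDualWalk.dualLength_eq_faceDist (hc : R.dualGraph.Connected)
    (hw : ∀ d : G.Dart, w d.edge = Nat.dist (h (R.face d)) (h (R.face d.symm)))
    {F F' : R.Face} {l : List G.Dart} (hl : R.IsDualWalk F l F') (hinc : R.IsIncreasing h l) :
    dualLength w l = R.faceDist w F F' := by
  refine le_antisymm ?_ (faceDist_le w hl)
  obtain ⟨l', hl', hlen⟩ := exists_dualLength_eq_faceDist hc w F F'
  rw [← hlen, ← Nat.add_le_add_iff_left (n := h F), hl.dualLength_eq_of_isIncreasing hw hinc]
  exact hl'.le_add_dualLength hw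

theorem IsDualWalk.isDualPath_of_isIncreasing {F F' : R.Face} {l : List G.Dart}
    (hl : R.IsDualWalk F l F') (hinc : R.IsIncreasing h l) : R.IsDualPath F l F' := by
  suffices hchain : ((F :: l.map fun d => R.face d.symm).map h).IsChain (· < ·) from
    ⟨hl, List.Nodup.of_map h ((List.isChain_iff_pairwise.mp hchain).imp fun hlt => hlt.ne)⟩
  induction l generalizing F with
  | nil => exact List.isChain_singleton _
  | cons d l ih =>
    obtain ⟨rfl, hl⟩ := hl
    obtain ⟨hd, hinc⟩ := isIncreasing_cons.mp hinc
    exact List.isChain_cons_cons.mpr ⟨hd, ih hl hinc⟩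

theorem exists_increasing_walk_from {s : R.Face}
    (hdown : ∀ F ≠ s, ∃ F', R.dualGraph.Adj F F' ∧ h F' < h F) (F : R.Face) :
    ∃ l, R.IsDualWalk s l F ∧ R.IsIncreasing h l := by
  induction F using (measure h).wf.induction with
  | _ F ih =>
    rcases eq_or_ne F s with rfl | hF
    · exact ⟨[], rfl, List.forall_mem_nil _⟩
    · obtain ⟨F', hadj, hlt⟩ := hdown F hF
      obtain ⟨-, d, rfl, rfl⟩ := hadj.symm
      obtain ⟨l, hl, hinc⟩ := ih _ hlt
      exact ⟨l ++ [d], hl.append ⟨rfl, rfl⟩,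
        isIncreasing_append.mpr ⟨hinc, List.forall_mem_singleton.mpr hlt⟩⟩

theorem exists_increasing_walk_to [Finite V] {t : R.Face}
    (hup : ∀ F ≠ t, ∃ F', R.dualGraph.Adj F F' ∧ h F < h F') (F : R.Face) :
    ∃ l, R.IsDualWalk F l t ∧ R.IsIncreasing h l := by
  have := R.finite_face
  have hwf : WellFounded fun F F' : R.Face => h F' < h F :=
    Finite.wellFounded_of_trans_of_irrefl (InvImage (· > ·) h)
  induction F using hwf.induction with
  | _ F ih =>
    rcases eq_or_ne F t with rfl | hF
    · exact ⟨[], rfl, List.forall_mem_nil _⟩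
    · obtain ⟨_, ⟨-, d, rfl, rfl⟩, hlt⟩ := hup F hF
      obtain ⟨l, hl, hinc⟩ := ih _ hlt
      exact ⟨d :: l, ⟨rfl, hl⟩, isIncreasing_cons.mpr ⟨hlt, hinc⟩⟩

theorem isBalanced_of_numbering [Finite V] (hc : R.dualGraph.Connected)
    (hinj : Function.Injective h) (hne : ∀ d, R.face d.symm ≠ R.face d) {s t : R.Face}
    (hdown : ∀ F ≠ s, ∃ F', R.dualGraph.Adj F F' ∧ h F' < h F)
    (hup : ∀ F ≠ t, ∃ F', R.dualGraph.Adj F F' ∧ h F < h F')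
    (hw : ∀ d : G.Dart, w d.edge = Nat.dist (h (R.face d)) (h (R.face d.symm))) :
    R.IsBalanced w s t := by
  intro e he
  obtain ⟨d, hd, rfl⟩ : ∃ d : G.Dart, h (R.face d) < h (R.face d.symm) ∧ d.edge = e := by
    induction e with
    | _ x y =>
      rcases lt_or_gt_of_ne (hinj.ne (hne ⟨(x, y), he⟩)) with hlt | hlt
      · exact ⟨_, by rwa [Dart.symm_symm], Dart.edge_symm ⟨(x, y), he⟩⟩
      · exact ⟨_, hlt, rfl⟩
  obtain ⟨l, hl, hinc⟩ := exists_increasing_walk_from hdown (R.face d)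
  obtain ⟨l', hl', hinc'⟩ := exists_increasing_walk_to hup (R.face d.symm)
  have hwalk : R.IsDualWalk s (l ++ d :: l') t := hl.append ⟨rfl, hl'⟩
  have hincr : R.IsIncreasing h (l ++ d :: l') :=
    isIncreasing_append.mpr ⟨hinc, isIncreasing_cons.mpr ⟨hd, hinc'⟩⟩
  exact ⟨_, hwalk.isDualPath_of_isIncreasing hincr, hwalk.dualLength_eq_faceDist hc hw hincr, d,
    by simp, rfl⟩

theorem exists_edge_weight (R : RotationSystem G) (h : R.Face → ℕ) :
    ∃ w : Sym2 V → ℕ, ∀ d : G.Dart, w d.edge = Nat.dist (h (R.face d)) (h (R.face d.symm)) := by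
  refine ⟨Function.extend Dart.edge (fun d => Nat.dist (h (R.face d)) (h (R.face d.symm))) 0,
    Function.FactorsThrough.extend_apply (fun d d' hdd' => ?_) _⟩
  rcases (dart_edge_eq_iff _ _).mp hdd' with rfl | rfl
  · rfl
  · rw [Dart.symm_symm, Nat.dist_comm]

variable [Finite V]

theorem IsPlane.exists_balanced_weight (hR : R.IsPlane) (h2 : G.IsVertexConnected 2)
    {s t : R.Face} (hst : s ≠ t) :
    ∃ w : Sym2 V → ℕ, (∀ e ∈ G.edgeSet, 0 < w e) ∧ R.IsBalanced w s t := by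
  have := R.finite_face
  have hc := hR.dualGraph_connected h2
  obtain ⟨h, hinj, hdown, hup⟩ := exists_st_numbering hc (hR.dualGraph_induce_preconnected h2) hst
  obtain ⟨w, hw⟩ := R.exists_edge_weight h
  have hpos : ∀ d : G.Dart, 0 < w d.edge := fun d => by
    rw [hw]
    exact Nat.dist_pos_of_ne (hinj.ne (hR.face_symm_ne h2 d).symm)
  refine ⟨w, fun e he => ?_,
    isBalanced_of_numbering hc hinj (hR.face_symm_ne h2) hdown hup hw⟩
  induction e with
  | _ x y => exact hpos ⟨(x, y), he⟩

end Numbering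

end SimpleGraph.RotationSystem

namespace SimpleGraph.RotationSystem

section TightCover

variable {V ι : Type*} [Fintype ι] {G : SimpleGraph V} {R : RotationSystem G}

/-- The conditions (3) and (4) on the end of an edge of weight `γ` that lies in the face `F₀` and is
joined to the vertices `x j` by edges of weights `η j`: moving this end to another face does not
pay, and it is neutral for some face that is not incident with `x i`. -/
def IsTightCover (R : RotationSystem G) (w : Sym2 V → ℕ) (F₀ : R.Face) (x : ι → V) (γ : ℕ)
    (η : ι → ℕ) : Prop :=
  (∀ F, R.faceDist w F₀ F * γ ≤ ∑ j, R.vertexDist w (x j) F * η j) ∧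
    ∀ i, ∃ F, 0 < R.vertexDist w (x i) F ∧
      ∑ j, R.vertexDist w (x j) F * η j = R.faceDist w F₀ F * γ

theorem IsTightCover.mul (hc : R.dualGraph.Connected) {w : Sym2 V → ℕ} {F₀ : R.Face} {x : ι → V}
    (hx : ∀ j, R.Incident (x j) F₀) {γ : ℕ} {η : ι → ℕ} (h : R.IsTightCover w F₀ x γ η) {n : ℕ}
    (hn : 0 < n) : R.IsTightCover (fun e => n * w e) F₀ x γ η := by
  simp only [IsTightCover, faceDist_mul hc, fun j => vertexDist_mul hc w n ⟨F₀, hx j⟩, mul_assoc,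
    ← Finset.mul_sum]
  refine ⟨fun F => Nat.mul_le_mul_left n (h.1 F), fun i => ?_⟩
  obtain ⟨F, hpos, heq⟩ := h.2 i
  exact ⟨F, Nat.mul_pos hn hpos, congrArg (n * ·) heq⟩

variable [Finite V]

theorem IsPlane.exists_other_face (hR : R.IsPlane) (h2 : G.IsVertexConnected 2) {x : V}
    (hx : (G.neighborSet x).ncard = 2) {F : R.Face} (hF : R.Incident x F) :
    ∃ U ≠ F, ∀ F', R.Incident x F' ↔ F' = F ∨ F' = U := by
  obtain ⟨c, rfl, rfl⟩ := hF
  refine ⟨R.face c.symm, hR.face_symm_ne h2 c, fun F' => ⟨?_, ?_⟩⟩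
  · rintro ⟨d, hd, rfl⟩
    exact (eq_or_ne (R.face d) (R.face c)).imp_right fun h =>
      (face_symm_eq_of_degree_two h2 hd.symm hx h.symm).symm
  · rintro (rfl | rfl)
    · exact ⟨c, rfl, rfl⟩
    · exact ⟨R.rot c, R.rot_fst c, R.face_rot c⟩

variable [Nontrivial ι]

theorem IsPlane.exists_isTightCover (hR : R.IsPlane) (hG : G.IsInternallyThreeConnected)
    (hV : 6 ≤ Nat.card V) {x : ι → V} (hx : Function.Injective x)
    (hdeg : ∀ i, (G.neighborSet (x i)).ncard = 2) {F₀ : R.Face} (hF₀ : ∀ i, R.Incident (x i) F₀)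
    {w : Sym2 V → ℕ} (hw : ∀ e ∈ G.edgeSet, 0 < w e) :
    ∃ α : ι → ℚ, (∀ j, 0 < α j) ∧ ∀ (γ : ℕ) (η : ι → ℕ), (∀ j, (η j : ℚ) = γ * α j) →
      R.IsTightCover w F₀ x γ η := by
  have := R.finite_face
  have hc := hR.dualGraph_connected hG.1
  have hface : ∀ {F}, R.faceDist w F₀ F = 0 ↔ F₀ = F := faceDist_eq_zero_iff hc hw
  have hvertex : ∀ {i F}, R.vertexDist w (x i) F = 0 ↔ R.Incident (x i) F :=
    fun {i F} => vertexDist_eq_zero_iff hc hw ⟨F₀, hF₀ i⟩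
  choose U hUF₀ hU using fun i => hR.exists_other_face hG.1 (hdeg i) (hF₀ i)
  have hxU : ∀ i, R.Incident (x i) (U i) := fun i => (hU i _).mpr (Or.inr rfl)
  have hUinj : Function.Injective U := fun i j hij => by
    by_contra hne
    exact hUF₀ i (hR.face_eq_of_incident hG hV (hx.ne hne) (hdeg i) (hdeg j) (hxU i) (hF₀ i)
      (hij ▸ hxU j) (hF₀ j))
  have hout : ∀ i F, (R.vertexDist w (x i) F : ℚ) = 0 → F = U i ∨ (R.faceDist w F₀ F : ℚ) ≤ 0 :=
    fun i F hF => by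
      rcases (hU i F).mp (hvertex.mp (Nat.cast_eq_zero.mp hF)) with rfl | rfl
      · exact Or.inr (Nat.cast_eq_zero.mpr (hface.mpr rfl)).le
      · exact Or.inl rfl
  obtain ⟨α, hα, hcover, htight⟩ := exists_tight_coefficients (k := ℚ)
    (r := fun F => R.faceDist w F₀ F) (D := fun j F => R.vertexDist w (x j) F) hUinj
    (fun _ _ => Nat.cast_nonneg _) (fun i => Nat.cast_eq_zero.mpr (hvertex.mpr (hxU i)))
    hout fun i => Nat.cast_pos.mpr (Nat.pos_of_ne_zero (hface.not.mpr (hUF₀ i).symm))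
  refine ⟨α, hα, fun γ η hη => ?_⟩
  have hsum : ∀ F, ((∑ j, R.vertexDist w (x j) F * η j : ℕ) : ℚ) =
      (∑ j, R.vertexDist w (x j) F * α j) * γ := fun F => by
    push_cast
    rw [Finset.sum_mul]
    exact Finset.sum_congr rfl fun j _ => by rw [hη, mul_comm (γ : ℚ), mul_assoc]
  refine ⟨fun F => ?_, fun i => ?_⟩
  · rw [← Nat.cast_le (α := ℚ), hsum, Nat.cast_mul]
    exact mul_le_mul_of_nonneg_right (hcover F) (Nat.cast_nonneg γ)
  · obtain ⟨F, hpos, heq⟩ := htight i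
    refine ⟨F, Nat.cast_pos.mp hpos, ?_⟩
    rw [← Nat.cast_inj (R := ℚ), hsum, heq, Nat.cast_mul]

/-- The conditions (1) to (7) are all met for a large multiple `n * w` of balanced weights `w`: (2)
and (7) hold because `n ^ 2` and `n` outgrow what they are compared with. -/
theorem IsPlane.exists_weights {κ : Type*} [Fintype κ] [Nontrivial κ] (hR : R.IsPlane)
    (hG : G.IsInternallyThreeConnected) (hV : 6 ≤ Nat.card V) {a : ι → V} {b : κ → V}
    (ha : Function.Injective a) (hb : Function.Injective b)
    (hdega : ∀ i, (G.neighborSet (a i)).ncard = 2) (hdegb : ∀ j, (G.neighborSet (b j)).ncard = 2)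
    {A B : R.Face} (hA : ∀ i, R.Incident (a i) A) (hB : ∀ j, R.Incident (b j) B) (hAB : A ≠ B)
    {ε : ℚ} (hε : 0 < ε) :
    ∃ (w : Sym2 V → ℕ) (γ : ℕ) (η : ι → ℕ) (θ : κ → ℕ), (∀ e ∈ G.edgeSet, 0 < w e) ∧ 0 < γ ∧
      (∀ i, 0 < η i) ∧ (∀ j, 0 < θ j) ∧ R.IsBalanced w A B ∧
      (∀ e ∈ G.edgeSet, ∀ e' ∈ G.edgeSet, R.faceDist w A B * γ < w e * w e') ∧
      R.IsTightCover w A a γ η ∧ R.IsTightCover w B b γ θ ∧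
      ∀ i j, ∀ e ∈ G.edgeSet, (η i * θ j : ℚ) < ε * w e := by
  have hc := hR.dualGraph_connected hG.1
  obtain ⟨w, hw, hbal⟩ := hR.exists_balanced_weight hG.1 hAB
  obtain ⟨α, hα, hαcover⟩ := hR.exists_isTightCover hG hV ha hdega hA hw
  obtain ⟨β, hβ, hβcover⟩ := hR.exists_isTightCover hG hV hb hdegb hB hw
  obtain ⟨γ, hγ, η, hη, hηeq⟩ := exists_common_denominator (α := Sum.elim α β)
    (Sum.forall.mpr ⟨hα, hβ⟩)
  obtain ⟨m, hm⟩ := exists_nat_gt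
    ((∑ i, (η (Sum.inl i) : ℚ)) * (∑ j, (η (Sum.inr j) : ℚ)) / ε)
  obtain ⟨n, hnγ, hnm⟩ : ∃ n, R.faceDist w A B * γ < n ∧ m ≤ n :=
    ⟨R.faceDist w A B * γ + m + 1, by lia, by lia⟩
  have hnw : ∀ e ∈ G.edgeSet, n ≤ n * w e := fun e he => Nat.le_mul_of_pos_right n (hw e he)
  refine ⟨fun e => n * w e, γ, η ∘ Sum.inl, η ∘ Sum.inr, fun e he => Nat.mul_pos (by lia) (hw e he),
    hγ, fun i => hη _, fun j => hη _, hbal.mul hc n, fun e he e' he' => ?_,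
    (hαcover γ _ fun i => hηeq (Sum.inl i)).mul hc hA (by lia),
    (hβcover γ _ fun j => hηeq (Sum.inr j)).mul hc hB (by lia), fun i j e he => ?_⟩
  · rw [faceDist_mul hc, mul_assoc]
    exact (Nat.mul_lt_mul_of_pos_left hnγ (by lia)).trans_le
      (Nat.mul_le_mul (hnw e he) (hnw e' he'))
  · calc (η (Sum.inl i) * η (Sum.inr j) : ℚ)
        ≤ (∑ i, (η (Sum.inl i) : ℚ)) * ∑ j, (η (Sum.inr j) : ℚ) := by
          gcongr
          · exact Finset.single_le_sum (f := fun i => (η (Sum.inl i) : ℚ))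
              (fun _ _ => Nat.cast_nonneg _) (Finset.mem_univ i)
          · exact Finset.single_le_sum (f := fun j => (η (Sum.inr j) : ℚ))
              (fun _ _ => Nat.cast_nonneg _) (Finset.mem_univ j)
      _ < ε * m := (div_lt_iff₀' hε).mp hm
      _ ≤ ε * (n * w e : ℕ) := by
          gcongr
          exact hnm.trans (hnw e he)

end TightCover

end SimpleGraph.RotationSystem

section VertexConnectivity

open SimpleGraph

variable {V W : Type*} [Finite V] {H : SimpleGraph V} {K : SimpleGraph W}

theorem isVertexConnected_of_copy {k : ℕ} (f : Copy K H) (hK : K.IsVertexConnected k)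
    (hf : ∀ x ∉ Set.range f, k ≤ {y | H.Adj x (f y)}.ncard) : H.IsVertexConnected k := by
  have := Finite.of_injective _ f.injective
  refine ⟨hK.1.trans_le (Nat.card_le_card_of_injective _ f.injective), fun S hS => ?_⟩
  have hfS : (f ⁻¹' S).ncard < k :=
    (Set.ncard_le_ncard_of_injOn f (fun _ hy => hy) f.injective.injOn).trans_lt hS
  have hKS := hK.2 _ hfS
  obtain ⟨z⟩ := hKS.nonempty
  let g : K.induce (f ⁻¹' S)ᶜ →g H.induce Sᶜ := ⟨fun y => ⟨f y, y.2⟩, fun h => f.toHom.map_adj h⟩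
  refine (connected_iff_exists_forall_reachable _).mpr ⟨g z, fun ⟨x, hx⟩ => ?_⟩
  by_cases hxf : x ∈ Set.range f
  · obtain ⟨y, rfl⟩ := hxf
    exact (hKS.preconnected z ⟨y, hx⟩).map g
  · obtain ⟨y, hxy, hyS⟩ := Set.exists_mem_notMem_of_ncard_lt_ncard (hfS.trans_le (hf x hxf))
    have hadj : (H.induce Sᶜ).Adj ⟨x, hx⟩ (g ⟨y, hyS⟩) := hxy
    exact ((hKS.preconnected z ⟨y, hyS⟩).map g).trans hadj.symm.reachable

end VertexConnectivity

section DeletedEnds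

open SimpleGraph

variable {V : Type*} {G : SimpleGraph V} {u v : V}

theorem notMem_range_deleteEndsCopy {x : V} :
    x ∉ Set.range (G.deleteEndsCopy u v) ↔ x = u ∨ x = v := by
  change x ∉ Set.range ((↑) : ↥({u, v}ᶜ : Set V) → V) ↔ _
  rw [Subtype.range_coe, Set.notMem_compl_iff]
  rfl

theorem deleteEdges_adj_coe {x : V} (y : ↥({u, v}ᶜ : Set V)) :
    (G.deleteEdges {s(u, v)}).Adj x y ↔ G.Adj x y := by
  refine deleteEdges_adj.trans (and_iff_left fun he => y.2 ?_)
  exact Sym2.mem_iff.mp (Set.mem_singleton_iff.mp he ▸ Sym2.mem_mk_right x (y : V))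

variable {ι κ : Type*} {a : ι → ↥({u, v}ᶜ : Set V)} {b : κ → ↥({u, v}ᶜ : Set V)}

/-- The edges of `G - {u, v}`, the edges from `u` to the `a i`, the edges from `v` to the `b j`, and
the edge `uv`, as one family: a weight on `G` can be prescribed on each of these parts. -/
def edgeFamily (a : ι → ↥({u, v}ᶜ : Set V)) (b : κ → ↥({u, v}ᶜ : Set V)) :
    Sym2 ↥({u, v}ᶜ : Set V) ⊕ ι ⊕ κ ⊕ Unit → Sym2 V :=
  Sum.elim (Sym2.map Subtype.val) <| Sum.elim (fun i => s(u, ↑(a i))) <|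
    Sum.elim (fun j => s(v, ↑(b j))) fun _ => s(u, v)

theorem edgeFamily_injective (huv : u ≠ v) (ha : Function.Injective a)
    (hb : Function.Injective b) : Function.Injective (edgeFamily a b) := by
  have hmem (e : Sym2 ↥({u, v}ᶜ : Set V)) {x y : V} (hx : x = u ∨ x = v) :
      e.map Subtype.val ≠ s(x, y) := fun he => by
    obtain ⟨z, -, rfl⟩ := Sym2.mem_map.mp (he ▸ Sym2.mem_mk_left x y)
    exact z.2 hx
  refine (Sym2.map.injective Subtype.val_injective).sumElim (Function.Injective.sumElim
    (fun i j hij => ha (Subtype.ext (Sym2.congr_right.mp hij))) (Function.Injective.sumElim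
    (fun i j hij => hb (Subtype.ext (Sym2.congr_right.mp hij)))
    (Function.injective_of_subsingleton _) fun j _ hj => ?_) ?_) ?_
  · exact (b j).2 (Or.inl (Sym2.congr_left.mp (Sym2.eq_swap.trans hj)))
  · rintro i (j | _) hi
    · rcases Sym2.mem_iff.mp (hi ▸ Sym2.mem_mk_left u (a i : V)) with h | h
      exacts [huv h, (b j).2 (Or.inl h.symm)]
    · exact (a i).2 (Or.inr (Sym2.congr_right.mp hi))
  · rintro e (i | j | _)
    exacts [hmem e (.inl rfl), hmem e (.inr rfl), hmem e (.inl rfl)]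

theorem exists_weight_extension (huv : u ≠ v) (ha : Function.Injective a)
    (hb : Function.Injective b) {w : Sym2 ↥({u, v}ᶜ : Set V) → ℕ} {γ : ℕ} {η : ι → ℕ} {θ : κ → ℕ}
    (hw : ∀ e ∈ (G.induce {u, v}ᶜ).edgeSet, 0 < w e) (hγ : 0 < γ) (hη : ∀ i, 0 < η i)
    (hθ : ∀ j, 0 < θ j) :
    ∃ ω : Sym2 V → ℕ, (∀ e ∈ G.edgeSet, 0 < ω e) ∧ (∀ e, w e = ω (e.map Subtype.val)) ∧
      ω s(u, v) = γ ∧ (∀ i, ω s(u, ↑(a i)) = η i) ∧ ∀ j, ω s(v, ↑(b j)) = θ j := by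
  let ω : Sym2 V → ℕ := Function.extend (edgeFamily a b)
    (Sum.elim w (Sum.elim η (Sum.elim θ fun _ => γ))) 1
  have hω (t) : ω (edgeFamily a b t) = _ := (edgeFamily_injective huv ha hb).extend_apply _ _ t
  refine ⟨ω, fun e he => ?_, fun e => (hω (.inl e)).symm, hω (.inr (.inr (.inr ()))),
    fun i => hω (.inr (.inl i)), fun j => hω (.inr (.inr (.inl j)))⟩
  by_cases het : ∃ t, edgeFamily a b t = e
  · obtain ⟨e' | i | j | _, rfl⟩ := het <;> rw [hω]
    · refine hw e' ?_
      induction e' with | _ x y => exact he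
    · exact hη i
    · exact hθ j
    · exact hγ
  · simp only [ω, Function.extend_apply' _ _ _ het, Pi.one_apply, one_pos]

variable [Finite V]

theorem ncard_neighborSet_deleteEdges (x : ↥({u, v}ᶜ : Set V)) :
    ((G.deleteEdges {s(u, v)}).neighborSet x).ncard =
      ((G.induce {u, v}ᶜ).neighborSet x).ncard + {w ∈ ({u, v} : Set V) | G.Adj w x}.ncard := by
  have hinter : (G.deleteEdges {s(u, v)}).neighborSet x ∩ {u, v} =
      {w ∈ ({u, v} : Set V) | G.Adj w x} := by
    ext w
    exact and_comm.trans (and_congr_right fun _ =>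
      (adj_comm _ _ _).trans (deleteEdges_adj_coe x))
  have hdiff : (G.deleteEdges {s(u, v)}).neighborSet x \ {u, v} =
      Subtype.val '' (G.induce {u, v}ᶜ).neighborSet x := by
    ext w
    refine ⟨fun ⟨hw, hwuv⟩ => ⟨⟨w, hwuv⟩, (deleteEdges_adj_coe ⟨w, hwuv⟩).mp hw, rfl⟩, ?_⟩
    rintro ⟨y, hy, rfl⟩
    exact ⟨(deleteEdges_adj_coe y).mpr hy, y.2⟩
  rw [← Set.ncard_inter_add_ncard_sdiff_eq_ncard _ {u, v}, hinter, hdiff,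
    Set.ncard_image_of_injective _ Subtype.val_injective, add_comm]

theorem ncard_neighborSet_induce_eq_two (hK : (G.induce {u, v}ᶜ).IsVertexConnected 2)
    {x : ↥({u, v}ᶜ : Set V)} (hx : ((G.deleteEdges {s(u, v)}).neighborSet x).ncard = 3) {s : V}
    (hs : s ∈ ({u, v} : Set V)) (hsx : G.Adj s x) :
    ((G.induce {u, v}ᶜ).neighborSet x).ncard = 2 := by
  have hdeg := ncard_neighborSet_deleteEdges (G := G) x
  have hle := hK.two_le_ncard_neighborSet x
  have hpos : 0 < {w ∈ ({u, v} : Set V) | G.Adj w x}.ncard :=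
    (Set.ncard_pos).mpr ⟨s, hs, hsx⟩
  lia

theorem not_adj_and_adj_of_ncard_neighborSet (huv : u ≠ v)
    (hK : (G.induce {u, v}ᶜ).IsVertexConnected 2) {x : ↥({u, v}ᶜ : Set V)}
    (hx : ((G.deleteEdges {s(u, v)}).neighborSet x).ncard = 3) : ¬(G.Adj u x ∧ G.Adj v x) := by
  rintro ⟨hux, hvx⟩
  have hdeg := ncard_neighborSet_deleteEdges (G := G) x
  have hle := hK.two_le_ncard_neighborSet x
  have hlt : 1 < {w ∈ ({u, v} : Set V) | G.Adj w x}.ncard :=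
    (Set.one_lt_ncard_iff).mpr ⟨u, v, ⟨Or.inl rfl, hux⟩, ⟨Or.inr rfl, hvx⟩, huv⟩
  lia

theorem card_add_card_le_card_compl [Fintype ι] [Fintype κ] (huv : u ≠ v)
    (hK : (G.induce {u, v}ᶜ).IsVertexConnected 2)
    (hdeg : ∀ i, ((G.deleteEdges {s(u, v)}).neighborSet (a i)).ncard = 3)
    (ha : Function.Injective a) (hb : Function.Injective b)
    (hua : ∀ i, G.Adj u (a i)) (hvb : ∀ j, G.Adj v (b j)) :
    Fintype.card ι + Fintype.card κ ≤ Nat.card ↥({u, v}ᶜ : Set V) := by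
  have hab : Function.Injective (Sum.elim a b) := ha.sumElim hb fun i j hij =>
    not_adj_and_adj_of_ncard_neighborSet huv hK (hdeg i) ⟨hua i, hij ▸ hvb j⟩
  rw [← Fintype.card_sum, ← Nat.card_eq_fintype_card]
  exact Nat.card_le_card_of_injective _ hab

theorem isVertexConnected_deleteEdges [Nontrivial ι] [Nontrivial κ]
    (hK : (G.induce {u, v}ᶜ).IsVertexConnected 2)
    (ha : Function.Injective a) (hb : Function.Injective b)
    (hua : ∀ i, G.Adj u (a i)) (hvb : ∀ j, G.Adj v (b j)) :
    (G.deleteEdges {s(u, v)}).IsVertexConnected 2 := by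
  refine isVertexConnected_of_copy (G.deleteEndsCopy u v) hK fun x hx =>
    (Set.one_lt_ncard_iff).mpr ?_
  rcases notMem_range_deleteEndsCopy.mp hx with rfl | rfl
  · obtain ⟨i, j, hij⟩ := exists_pair_ne ι
    exact ⟨a i, a j, (deleteEdges_adj_coe _).mpr (hua i), (deleteEdges_adj_coe _).mpr (hua j),
      ha.ne hij⟩
  · obtain ⟨i, j, hij⟩ := exists_pair_ne κ
    exact ⟨b i, b j, (deleteEdges_adj_coe _).mpr (hvb i), (deleteEdges_adj_coe _).mpr (hvb j),
      hb.ne hij⟩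

theorem deletesApart_deleteEndsCopy (huv : G.Adj u v) (hnonplanar : ¬G.IsPlanar)
    (h2 : (G.deleteEdges {s(u, v)}).IsVertexConnected 2)
    {M : (G.deleteEdges {s(u, v)}).RotationSystem} (hM : M.IsPlane) :
    M.DeletesApart (G.deleteEndsCopy u v) where
  isPlane := hM
  isVertexConnected := h2
  mem_range_dartMap := by
    rintro ⟨⟨x, y⟩, hxy⟩ ⟨x, rfl⟩ ⟨y, rfl⟩
    exact ⟨⟨(x, y), (deleteEdges_adj_coe y).mp hxy⟩, rfl⟩
  fst_eq_of_face_eq δ ε hδ hε hface := by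
    have hc := h2.connected two_pos
    rcases notMem_range_deleteEndsCopy.mp hδ with hδ | hδ <;>
      rcases notMem_range_deleteEndsCopy.mp hε with hε | hε
    · exact hδ.trans hε.symm
    · exact (hnonplanar (hM.isPlanar_of_face_eq hc huv hδ hε hface)).elim
    · exact (hnonplanar (hM.isPlanar_of_face_eq hc huv hε hδ hface.symm)).elim
    · exact hδ.trans hε.symm

theorem exists_faces_incident (huv : u ≠ v) {M : (G.deleteEdges {s(u, v)}).RotationSystem}
    (h : M.DeletesApart (G.deleteEndsCopy u v)) :
    ∃ Fu Fv : (M.restrict (G.deleteEndsCopy u v)).Face, Fu ≠ Fv ∧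
      (∀ x : ↥({u, v}ᶜ : Set V), G.Adj u x →
        (M.restrict (G.deleteEndsCopy u v)).Incident x Fu) ∧
      ∀ x : ↥({u, v}ᶜ : Set V), G.Adj v x →
        (M.restrict (G.deleteEndsCopy u v)).Incident x Fv := by
  obtain ⟨Φ, hΦ, hinc⟩ := h.exists_face_incident
  refine ⟨Φ ⟨u, notMem_range_deleteEndsCopy.mpr (Or.inl rfl)⟩,
    Φ ⟨v, notMem_range_deleteEndsCopy.mpr (Or.inr rfl)⟩,
    hΦ.ne fun huv' => huv (congrArg Subtype.val huv'), ?_, ?_⟩ <;>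
  exact fun x hx => hinc _ x ((deleteEdges_adj_coe x).mpr hx)

end DeletedEnds

theorem mainTheorem3_general {V ι κ : Type*} [Finite V] [Fintype ι] [Fintype κ] [Nontrivial ι]
    [Nontrivial κ] (hcard : 6 ≤ Fintype.card ι + Fintype.card κ) {G : SimpleGraph V} {u v : V}
    (huv : G.Adj u v) (hnonplanar : ¬G.IsPlanar)
    (hint : (G.induce {u, v}ᶜ).IsInternallyThreeConnected)
    {M : (G.deleteEdges {s(u, v)}).RotationSystem} (hM : M.IsPlane)
    {N : (G.induce {u, v}ᶜ).RotationSystem} (hN : N = M.restrict (G.deleteEndsCopy u v))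
    {a : ι → ↥({u, v}ᶜ : Set V)} {b : κ → ↥({u, v}ᶜ : Set V)}
    (hdega : ∀ i, ((G.deleteEdges {s(u, v)}).neighborSet (a i)).ncard = 3)
    (hdegb : ∀ j, ((G.deleteEdges {s(u, v)}).neighborSet (b j)).ncard = 3)
    (ha : Function.Injective a) (hb : Function.Injective b)
    (hua : ∀ i, G.Adj u (a i)) (hvb : ∀ j, G.Adj v (b j)) {ε : ℚ} (hε : 0 < ε) :
    ∃ Fu Fv : N.Face,
      (∀ F, (∀ i, N.Incident (a i) F) ↔ F = Fu) ∧ (∀ F, (∀ j, N.Incident (b j) F) ↔ F = Fv) ∧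
      ∃ ω : Sym2 V → ℕ, (∀ e ∈ G.edgeSet, 0 < ω e) ∧
        ∃ w : Sym2 ↥({u, v}ᶜ : Set V) → ℕ, (∀ e, w e = ω (e.map Subtype.val)) ∧
        N.IsBalanced w Fu Fv ∧
        (∀ e ∈ (G.induce {u, v}ᶜ).edgeSet, ∀ e' ∈ (G.induce {u, v}ᶜ).edgeSet,
          N.faceDist w Fu Fv * ω s(u, v) < w e * w e') ∧
        N.IsTightCover w Fu a (ω s(u, v)) (fun i => ω s(u, ↑(a i))) ∧
        N.IsTightCover w Fv b (ω s(u, v)) (fun j => ω s(v, ↑(b j))) ∧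
        ∀ i j, ∀ e ∈ (G.induce {u, v}ᶜ).edgeSet,
          (ω s(u, ↑(a i)) * ω s(v, ↑(b j)) : ℚ) < ε * w e := by
  subst hN
  have hK := hint.1
  have := hK.nonempty_dart
  have hapart := deletesApart_deleteEndsCopy huv hnonplanar
    (isVertexConnected_deleteEdges hK ha hb hua hvb) hM
  have hplane := hapart.isPlane_restrict (hK.connected two_pos)
  have hdega2 i := ncard_neighborSet_induce_eq_two hK (hdega i) (Or.inl rfl) (hua i)
  have hdegb2 j := ncard_neighborSet_induce_eq_two hK (hdegb j) (Or.inr rfl) (hvb j)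
  have hV := hcard.trans (card_add_card_le_card_compl huv.ne hK hdega ha hb hua hvb)
  obtain ⟨Fu, Fv, hne, hFu, hFv⟩ := exists_faces_incident huv.ne hapart
  obtain ⟨w, γ, η, θ, hw, hγ, hη, hθ, hbal, hlt, hcovera, hcoverb, hsmall⟩ :=
    hplane.exists_weights hint hV ha hb hdega2 hdegb2 (fun i => hFu _ (hua i))
      (fun j => hFv _ (hvb j)) hne hε
  obtain ⟨ω, hω, hwω, rfl, hωη, hωθ⟩ := exists_weight_extension huv.ne ha hb hw hγ hη hθ
  obtain rfl := funext hωη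
  obtain rfl := funext hωθ
  exact ⟨Fu, Fv,
    hplane.forall_incident_iff_eq hint hV ha hdega2 fun i => hFu _ (hua i),
    hplane.forall_incident_iff_eq hint hV hb hdegb2 fun j => hFv _ (hvb j),
    ω, hω, w, hwω, hbal, hlt, hcovera, hcoverb, hsmall⟩

theorem mainTheorem3 {V : Type*} [Finite V] (G : SimpleGraph V) (u v : V) (huv : G.Adj u v)
    (hnonplanar : ¬ G.IsPlanar)
    (hcubic : ∀ x, ((G.deleteEdges {s(u, v)}).neighborSet x).ncard = 3)
    (hconn : (G.deleteEdges {s(u, v)}).IsVertexConnected 3)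
    (hint : (G.induce {u, v}ᶜ).IsInternallyThreeConnected)
    -- a plane embedding of `G - uv`, and the embedding `N` of `G - {u, v}` that it induces
    (M : (G.deleteEdges {s(u, v)}).RotationSystem) (hM : M.IsPlane)
    (N : (G.induce {u, v}ᶜ).RotationSystem) (hN : N = M.restrict (G.deleteEndsCopy u v))
    -- the other neighbours `u₁, u₂, u₃` of `u` and `v₁, v₂, v₃` of `v`
    (a b : Fin 3 → ↥({u, v}ᶜ : Set V)) (ha : Function.Injective a) (hb : Function.Injective b)
    (hua : ∀ i, G.Adj u (a i)) (hvb : ∀ i, G.Adj v (b i)) :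
    ∃ Fu Fv : N.Face,
      -- `Fu` is the unique face incident with `u₁, u₂, u₃`, and likewise for `Fv`
      (∀ F, (∀ i, N.Incident (a i) F) ↔ F = Fu) ∧
      (∀ F, (∀ i, N.Incident (b i) F) ↔ F = Fv) ∧
      ∃ ω : Sym2 V → ℕ, (∀ e ∈ G.edgeSet, 0 < ω e) ∧
        -- the weights of `G - {u, v}`, and thus of its dual
        ∃ w : Sym2 ↥({u, v}ᶜ : Set V) → ℕ, (∀ e, w e = ω (e.map Subtype.val)) ∧
        -- (1)
        N.IsBalanced w Fu Fv ∧
        -- (2)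
        (∀ e ∈ (G.induce {u, v}ᶜ).edgeSet, ∀ e' ∈ (G.induce {u, v}ᶜ).edgeSet,
          w e * w e' > N.faceDist w Fu Fv * ω s(u, v)) ∧
        -- (3)
        (∀ F, ∑ i, N.vertexDist w (a i) F * ω s(u, ↑(a i)) ≥ N.faceDist w Fu F * ω s(u, v)) ∧
        -- (4)
        (∀ i, ∃ U, 0 < N.vertexDist w (a i) U ∧
          ∑ j, N.vertexDist w (a j) U * ω s(u, ↑(a j)) = N.faceDist w Fu U * ω s(u, v)) ∧
        -- (5)
        (∀ F, ∑ i, N.vertexDist w (b i) F * ω s(v, ↑(b i)) ≥ N.faceDist w Fv F * ω s(u, v)) ∧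
        -- (6)
        (∀ i, ∃ U, 0 < N.vertexDist w (b i) U ∧
          ∑ j, N.vertexDist w (b j) U * ω s(v, ↑(b j)) = N.faceDist w Fv U * ω s(u, v)) ∧
        -- (7)
        (∀ i j, ∀ e ∈ (G.induce {u, v}ᶜ).edgeSet,
          (ω s(u, ↑(a i)) * ω s(v, ↑(b j)) : ℚ) < 1 / 9 * w e) := by
  obtain ⟨Fu, Fv, hFu, hFv, ω, hω, w, hwω, hbal, hlt, hcovera, hcoverb, hsmall⟩ :=
    mainTheorem3_general le_rfl huv hnonplanar hint hM hN (fun i => hcubic (a i))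
      (fun j => hcubic (b j)) ha hb hua hvb (ε := 1 / 9) (by norm_num)
  exact ⟨Fu, Fv, hFu, hFv, ω, hω, w, hwω, hbal, hlt, hcovera.1, hcovera.2, hcoverb.1, hcoverb.2,
    hsmall⟩
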